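/- All posets are finite. A poset $P$ is $(\mathbf{3+1})$-avoiding if there are no $x<y<z$ and $w$ in $P$ with $w$ incomparable to each of $x,y,z$. A rank function on $P$ is a map $\operatorname{rk}:P\to\mathbf N$ with $\operatorname{rk}(b)=\operatorname{rk}(a)+1$ whenever $b$ covers $a$ and with minimal value $0$ on each connected component of the Hasse diagram; $P$ is strongly graded if it has a (necessarily unique) rank function, all minimal elements have the same rank, and all maximal elements have the same rank. The height of $P$ is the number of vertices in a longest chain. A vertex $v$ of rank $i$ is up-seeing if every vertex of rank $i+1$ covers $v$, down-seeing if $v$ covers every vertex of rank $i-1$, and all-seeing if it is both. A graded poset is trimmed if every vertex is up-seeing or down-seeing, each rank contains at most one all-seeing vertex, the all-seeing vertices are unlabeled, and the remaining $n$ vertices are labeled bijectively by $[n]=\{1,\dots,n\}$; such posets are counted up to label-preserving isomorphism. A nonempty strongly graded poset of height $h$ is sum-indecomposable if it is trimmed and there is no $i<h-1$ such that every vertex of rank $i$ is up-seeing. Let $$I_{\ge 2}(x,z)=\sum_{n,r\ge 0} a_{n,r}\,\frac{x^n}{n!}\,z^r\in\mathbf R[\![x,z]\!],$$ where $a_{n,r}$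 is the number of sum-indecomposable $(\mathbf{3+1})$-avoiding posets of height at least $2$ with $r$ all-seeing vertices and $n$ other vertices. For $\nu,\mu\in\{\circ,\otimes\}$ and $m,n\ge 1$ let $B^\nu_\mu(m,n)$ be the set of bipartite graphs on $[m]\uplus[n]$ in which no vertex of either part is adjacent to all vertices of the other part, such that $[n]$ contains at least one isolated vertex if $\nu=\circ$ and none if $\nu=\otimes$, and $[m]$ contains at least one isolated vertex if $\mu=\circ$ and none if $\mu=\otimes$. Let $$F^\nu_\mu(x)=\sum_{m,n\ge 1}|B^\nu_\mu(m,n)|\,\frac{x^{m+n}}{m!\,n!},$$ and let $$M=z\begin{bmatrix}F^\circ_\circ&F^\circ_\otimes&F^\otimes_\circ&F^\otimes_\otimes\\F^\circ_\circ&F^\circ_\otimes&F^\otimes_\circ&F^\otimes_\otimes\\F^\circ_\circ&F^\circ_\otimes&F^\otimes_\circ&F^\otimes_\otimes\\F^\circ_\circ&F^\circ_\otimes&F^\otimes_\circ&F^\otimes_\otimes\end{bmatrix}+\begin{bmatrix}0&0&F^\otimes_\circ&F^\otimes_\otimes\\F^\circ_\circ&F^\circ_\otimes&F^\otimes_\circ&F^\otimes_\otimes\\0&0&F^\otimes_\circ&F^\otimes_\otimes\\F^\circ_\circ&F^\circ_\otimes&F^\otimes_\circ&F^\otimes_\otimes\end{bmatrix},$$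 a $4\times4$ matrix over $\mathbf R[\![x,z]\!]$. Corollary. The matrix $\mathbb I-M$ is invertible over $\mathbf R[\![x,z]\!]$, and $$I_{\ge 2}(x,z)=\begin{bmatrix}zF^\circ_\circ&zF^\circ_\otimes&(1+z)F^\otimes_\circ&(1+z)F^\otimes_\otimes\end{bmatrix}\cdot(\mathbb I-M)^{-1}\cdot\begin{bmatrix}z\\1+z\\z\\1+z\end{bmatrix}.$$ -/

import Mathlib

open scoped Nat Matrix

noncomputable section

namespace TrimmedPosets

/-! ### Graded posets -/

section Graded

variable {V : Type*} [PartialOrder V]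

/-- No elements `x < y < z` and `w` with `w` incomparable to all of `x`, `y`, `z`. -/
def AvoidsThreePlusOne (V : Type*) [PartialOrder V] : Prop :=
  ¬ ∃ x y z w : V, x < y ∧ y < z ∧
    (¬ w ≤ x ∧ ¬ x ≤ w) ∧ (¬ w ≤ y ∧ ¬ y ≤ w) ∧ (¬ w ≤ z ∧ ¬ z ≤ w)

/-- `rk` is the rank function of a weakly graded poset: covers raise the rank by exactly one, and
the minimal rank occurring in each connected component (of the Hasse diagram) is `0`. -/
structure IsRankFunction (rk : V → ℕ) : Prop where
  covBy : ∀ a b : V, a ⋖ b → rk b = rk a + 1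
  component : ∀ a : V, ∃ b : V, (SimpleGraph.hasse V).Reachable a b ∧ rk b = 0

/-- A weakly graded poset with rank function `rk` is strongly graded: all minimal elements have
the same rank and all maximal elements have the same rank. -/
structure IsStronglyGraded (rk : V → ℕ) : Prop extends IsRankFunction rk where
  isMin : ∀ a b : V, IsMin a → IsMin b → rk a = rk b
  isMax : ∀ a b : V, IsMax a → IsMax b → rk a = rk b

/-- The number of vertices in a longest chain. -/
def height (V : Type*) [PartialOrder V] : ℕ∞ :=
  (Set.univ : Set V).chainHeight (· ≤ ·)

/-- Every vertex of the next higher rank covers `v`. -/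
def UpSeeing (rk : V → ℕ) (v : V) : Prop :=
  ∀ w : V, rk w = rk v + 1 → v ⋖ w

/-- `v` covers every vertex of the next lower rank. -/
def DownSeeing (rk : V → ℕ) (v : V) : Prop :=
  ∀ u : V, rk u + 1 = rk v → u ⋖ v

def AllSeeing (rk : V → ℕ) (v : V) : Prop :=
  UpSeeing rk v ∧ DownSeeing rk v

/-- Every vertex is up-seeing or down-seeing (or both). -/
def Vigilant (rk : V → ℕ) : Prop :=
  ∀ v : V, UpSeeing rk v ∨ DownSeeing rk v

/-- A vigilant poset, some of whose vertices (the set `U`) are unlabeled, is trimmed: every rank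
has at most one all-seeing vertex, and the unlabeled vertices are exactly the all-seeing ones. -/
structure IsTrimmed (rk : V → ℕ) (U : Set V) : Prop where
  vigilant : Vigilant rk
  allSeeing_unique : ∀ v w : V, AllSeeing rk v → AllSeeing rk w → rk v = rk w → v = w
  mem_unlabeled : ∀ v : V, v ∈ U ↔ AllSeeing rk v

/-- A poset with set `U` of unlabeled vertices is sum-indecomposable: it is nonempty, strongly
graded and trimmed, and there is no `i < height - 1` such that all vertices of rank `i` are
up-seeing. (A poset has at most one rank function.) -/
def IsSumIndecomposable (V : Type*) [PartialOrder V] (U : Set V) : Prop :=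
  Nonempty V ∧ ∃ rk : V → ℕ, IsStronglyGraded rk ∧ IsTrimmed rk U ∧
    ¬ ∃ i : ℕ, (i : ℕ∞) + 1 < height V ∧ ∀ v : V, rk v = i → UpSeeing rk v

end Graded

/-! ### Counting sum-indecomposable posets -/

/-- A vertex set with `n` vertices labeled by `Fin n` and `r` unlabeled vertices. The names of
the unlabeled vertices are forgotten in `LabelIso` below. -/
inductive Vertex (n r : ℕ) : Type
  | labeled (i : Fin n) : Vertex n r
  | unlabeled (j : Fin r) : Vertex n r

/-- The partial orders on `Vertex n r` that are sum-indecomposable, `(3+1)`-avoiding, and of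
height at least `2`. -/
def IndecStructure (n r : ℕ) : Type :=
  {P : PartialOrder (Vertex n r) //
    @IsSumIndecomposable (Vertex n r) P (Set.range Vertex.unlabeled) ∧
    @AvoidsThreePlusOne (Vertex n r) P ∧ 2 ≤ @height (Vertex n r) P}

/-- Isomorphism of posets that preserves all the labels. -/
def LabelIso {n r : ℕ} (P Q : IndecStructure n r) : Prop :=
  ∃ e : Vertex n r ≃ Vertex n r,
    (∀ i : Fin n, e (Vertex.labeled i) = Vertex.labeled i) ∧
    ∀ a b : Vertex n r, P.1.le a b ↔ Q.1.le (e a) (e b)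

/-- The label-preserving isomorphism classes. -/
instance labelIsoSetoid (n r : ℕ) : Setoid (IndecStructure n r) where
  r := LabelIso
  iseqv :=
    { refl := fun _ => ⟨Equiv.refl _, fun _ => rfl, fun _ _ => Iff.rfl⟩
      symm := by
        rintro P Q ⟨e, h, hle⟩
        refine ⟨e.symm, fun i => ?_, fun a b => ?_⟩
        · rw [Equiv.symm_apply_eq, h]
        · rw [hle, Equiv.apply_symm_apply, Equiv.apply_symm_apply]
      trans := by
        rintro P Q R ⟨e, h, hle⟩ ⟨f, h', hle'⟩
        refine ⟨e.trans f, fun i => ?_, fun a b => ?_⟩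
        · rw [Equiv.trans_apply, h, h']
        · rw [hle, hle', Equiv.trans_apply, Equiv.trans_apply] }

/-- The number of sum-indecomposable `(3+1)`-avoiding posets of height at least `2` with `r`
all-seeing (unlabeled) vertices and `n` other vertices, labeled by `n` labels. -/
def indecCount (n r : ℕ) : ℕ :=
  Nat.card (Quotient (labelIsoSetoid n r))

/-- The ring `ℝ⟦x, z⟧`, with `x` the variable of index `0` and `z` that of index `1`. -/
abbrev Series : Type := MvPowerSeries (Fin 2) ℝ

def z : Series := MvPowerSeries.X 1

/-- The generating function `I_{≥2}(x, z)`, exponential in `x` and ordinary in `z`. -/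
def indecSeries : Series :=
  fun d => (indecCount (d 0) (d 1) : ℝ) / ((d 0)! : ℝ)

/-! ### Quarks -/

/-- The two symbols for restrictions on isolated vertices of one part of a bipartite graph:
`circ` demands at least one isolated vertex, `otimes` (a crossed-out `circ`) demands none. -/
inductive Mark : Type
  | circ : Mark
  | otimes : Mark

/-- The restriction that the mark puts on a part, given the predicate "is isolated" on it. -/
def Mark.Holds {α : Type*} (isolated : α → Prop) : Mark → Prop
  | .circ => ∃ v, isolated v
  | .otimes => ¬ ∃ v, isolated v

/-- Bipartite graphs on `[m] ⊎ [n]`, given by the adjacency relation `G` between the lower part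
`[m]` and the upper part `[n]`, with no all-seeing vertex (one adjacent to all vertices of the
other part) in either part, and with the restriction `ν` on isolated vertices in `[n]` and the
restriction `μ` on isolated vertices in `[m]`. -/
def middleQuarks (ν μ : Mark) (m n : ℕ) : Set (Fin m → Fin n → Prop) :=
  {G | (¬ ∃ a, ∀ b, G a b) ∧ (¬ ∃ b, ∀ a, G a b) ∧
    ν.Holds (fun b => ∀ a, ¬ G a b) ∧ μ.Holds (fun a => ∀ b, ¬ G a b)}

/-- The coefficient of `x ^ N` in the series `F` with superscript `ν` and subscript `μ`. -/
def quarkCoeff (ν μ : Mark) (N : ℕ) : ℝ :=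
  ∑ p ∈ Finset.HasAntidiagonal.antidiagonal N with 1 ≤ p.1 ∧ 1 ≤ p.2,
    ((middleQuarks ν μ p.1 p.2).ncard : ℝ) / ((p.1)! * (p.2)! : ℝ)

/-- The series `F` with superscript `ν` and subscript `μ`, that is, the sum over `m, n ≥ 1` of
`|B(m, n)| x ^ (m + n) / (m! n!)`, as an element of `ℝ⟦x, z⟧` not involving `z`. -/
def F (ν μ : Mark) : Series :=
  fun d => if d 1 = 0 then quarkCoeff ν μ (d 0) else 0

open Mark in
/-- The transfer matrix. -/
def transferMatrix : Matrix (Fin 4) (Fin 4) Series :=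
  z • !![F circ circ, F circ otimes, F otimes circ, F otimes otimes;
         F circ circ, F circ otimes, F otimes circ, F otimes otimes;
         F circ circ, F circ otimes, F otimes circ, F otimes otimes;
         F circ circ, F circ otimes, F otimes circ, F otimes otimes] +
  !![0,           0,             F otimes circ, F otimes otimes;
     F circ circ, F circ otimes, F otimes circ, F otimes otimes;
     0,           0,             F otimes circ, F otimes otimes;
     F circ circ, F circ otimes, F otimes circ, F otimes otimes]

open Mark in
def initialVector : Fin 4 → Series :=
  ![z * F circ circ, z * F circ otimes, (1 + z) * F otimes circ, (1 + z) * F otimes otimes]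

def finalVector : Fin 4 → Series :=
  ![z, 1 + z, z, 1 + z]

end TrimmedPosets

end

namespace TrimmedPosets

/-! ### Rank functions on finite posets and comparability across two ranks -/

section RankTheory

variable {V : Type*} [PartialOrder V] [Finite V] {rk : V → ℕ}

/-! In a strongly graded `(3+1)`-avoiding poset, vertices whose ranks differ by at least two are
comparable (`IsStronglyGraded.lt_of_rank_add_two_le`), so the order is determined by adjacent ranks.
In a trimmed poset the only freedom between ranks `i` and `i + 1` lies between the vertices that are
not up-seeing and those that are not down-seeing. They span a bipartite graph without all-seeing
vertices, a quark; its lower part is nonempty exactly because the poset is sum-indecomposable. A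
poset with ranks `0, …, l` is thus a sequence of `l` quarks together with the set of ranks that hold
an all-seeing vertex.

The one constraint is local. If the quark below rank `j` has an isolated lower vertex `a` and the
quark above has an isolated upper vertex `b`, then `a < b`, and a vertex between them in rank `j`
must be all-seeing. At the two extreme ranks the missing quark behaves as if it had such an isolated
vertex, since the remaining one still needs a neighbour. Conversely, every choice that obeys this
constraint gives a poset of the class, whence `configClass_bijective`.

Quarks use disjoint sets of labels, so their exponential generating functions multiply. Each rank
contributes `z` when an all-seeing vertex is forced and `1 + z` otherwise, which depends only on the
marks of the two neighbouring quarks. Summing over words of marks is a path expansion of powers of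
the transfer matrix (`transferMatrix_pow_mulVec`). Every `F` is divisible by `x`, so the geometric
series converges `x`-adically. -/

theorem exists_covBy_le {a b : V} (h : a < b) : ∃ c, a ⋖ c ∧ c ≤ b := by
  obtain ⟨c, hcb, hc⟩ := (Set.toFinite {x : V | a < x}).exists_le_minimal h
  exact ⟨c, ⟨hc.prop, fun x hax hxc => (hc.not_lt hax hxc)⟩, hcb⟩

theorem exists_le_covBy {a b : V} (h : a < b) : ∃ c, a ≤ c ∧ c ⋖ b := by
  obtain ⟨c, hcb, hc⟩ := (Set.toFinite {x : V | x < b}).exists_le_maximal h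
  exact ⟨c, hcb, ⟨hc.prop, fun x hcx hxb => (hc.not_gt hxb hcx)⟩⟩

theorem IsRankFunction.strictMono (hr : IsRankFunction rk) : StrictMono rk := by
  intro a b
  induction b using WellFoundedLT.induction with
  | ind b ih =>
    intro h
    obtain ⟨c, hac, hcb⟩ := exists_le_covBy h
    rw [hr.covBy _ _ hcb]
    rcases hac.eq_or_lt with rfl | hlt
    · exact Nat.lt_succ_self _
    · exact (ih c hcb.lt hlt).trans (Nat.lt_succ_self _)

theorem IsStronglyGraded.eq_zero_of_isMin (hr : IsStronglyGraded rk) {a : V} (ha : IsMin a) :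
    rk a = 0 := by
  obtain ⟨b, -, hb⟩ := hr.component a
  obtain ⟨c, hcb, hc⟩ := (Set.toFinite (Set.univ : Set V)).exists_le_minimal (Set.mem_univ b)
  have hc' : IsMin c := fun x hx => hc.le_of_le (Set.mem_univ x) hx
  have h1 := hr.strictMono.monotone hcb
  rw [hr.isMin a c ha hc']
  omega

theorem IsStronglyGraded.eq (hr : IsStronglyGraded rk) {rk' : V → ℕ}
    (hr' : IsStronglyGraded rk') : rk = rk' := by
  funext b
  induction b using WellFoundedLT.induction with
  | ind b ih =>
    by_cases hb : IsMin b
    · rw [hr.eq_zero_of_isMin hb, hr'.eq_zero_of_isMin hb]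
    · obtain ⟨a, ha⟩ := not_isMin_iff.1 hb
      obtain ⟨c, -, hc⟩ := exists_le_covBy ha
      rw [hr.covBy _ _ hc, hr'.covBy _ _ hc, ih c hc.lt]

theorem IsStronglyGraded.exists_covBy_of_rank_ne_zero (hr : IsStronglyGraded rk) {b : V}
    (hb : rk b ≠ 0) : ∃ a, a ⋖ b := by
  obtain ⟨a, ha⟩ := not_isMin_iff.1 (mt hr.eq_zero_of_isMin hb)
  obtain ⟨c, -, hc⟩ := exists_le_covBy ha
  exact ⟨c, hc⟩

theorem IsStronglyGraded.exists_le_rank_eq (hr : IsStronglyGraded rk) (b : V) {k : ℕ}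
    (hk : k ≤ rk b) : ∃ a ≤ b, rk a = k := by
  induction b using WellFoundedLT.induction with
  | ind b ih =>
    rcases hk.eq_or_lt with rfl | hlt
    · exact ⟨b, le_rfl, rfl⟩
    · obtain ⟨c, hc⟩ := hr.exists_covBy_of_rank_ne_zero (b := b) (by omega)
      have := hr.covBy _ _ hc
      obtain ⟨a, hac, ha⟩ := ih c hc.lt (by omega)
      exact ⟨a, hac.trans hc.le, ha⟩

theorem IsRankFunction.covBy_iff (hr : IsRankFunction rk) {a b : V} :
    a ⋖ b ↔ a < b ∧ rk b = rk a + 1 := by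
  refine ⟨fun h => ⟨h.lt, hr.covBy _ _ h⟩, fun ⟨h, hk⟩ => ⟨h, fun c hac hcb => ?_⟩⟩
  have h1 := hr.strictMono hac
  have h2 := hr.strictMono hcb
  omega

/-- Below `b` there is a chain in ranks `rk a`, `rk a + 1`, `rk a + 2`. If `a < b` fails, none of
its members lies above `a`, and none lies strictly below `a` by rank, so the chain and `a` form a
forbidden `3+1`. -/
theorem IsStronglyGraded.lt_of_rank_add_two_le (hr : IsStronglyGraded rk)
    (hP : AvoidsThreePlusOne V) {a b : V} (h : rk a + 2 ≤ rk b) : a < b := by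
  by_contra hab
  obtain ⟨z, hzb, hz⟩ := hr.exists_le_rank_eq b h
  obtain ⟨y, hyz, hy⟩ := hr.exists_le_rank_eq z (k := rk a + 1) (by omega)
  obtain ⟨x, hxy, hx⟩ := hr.exists_le_rank_eq y (k := rk a) (by omega)
  have key : ∀ c, c ≤ b → rk a ≤ rk c → ¬ a ≤ c ∧ ¬ c ≤ a := by
    intro c hcb hac
    have h1 : ¬ a ≤ c := fun h1 => by
      rcases (h1.trans hcb).eq_or_lt with rfl | h2
      · omega
      · exact hab h2
    refine ⟨h1, fun h2 => ?_⟩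
    rcases h2.eq_or_lt with rfl | h3
    · exact h1 le_rfl
    · have := hr.strictMono h3
      omega
  refine hP ⟨x, y, z, a, lt_of_le_of_ne hxy ?_, lt_of_le_of_ne hyz ?_, key _ ?_ ?_, key _ ?_ ?_,
    key _ ?_ ?_⟩
  · rintro rfl; omega
  · rintro rfl; omega
  · exact hxy.trans (hyz.trans hzb)
  · omega
  · exact hyz.trans hzb
  · omega
  · exact hzb
  · omega

theorem IsStronglyGraded.isMax_iff (hr : IsStronglyGraded rk) {l : ℕ} (hl : ∀ v, rk v ≤ l)
    {t : V} (ht : rk t = l) {v : V} : IsMax v ↔ rk v = l := by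
  have key : ∀ w : V, rk w = l → IsMax w := fun w hw x hx => by
    rcases hx.eq_or_lt with rfl | h
    · exact le_rfl
    · have := hr.strictMono h
      have := hl x
      omega
  exact ⟨fun h => (hr.isMax v t h (key t ht)).trans ht, key v⟩

/-- The rank is injective on chains, which bounds their size; descending from `t` by covers attains
the bound. -/
theorem IsStronglyGraded.height_eq (hr : IsStronglyGraded rk) {l : ℕ} (hl : ∀ v, rk v ≤ l)
    {t : V} (ht : rk t = l) : height V = (l : ℕ∞) + 1 := by
  apply le_antisymm
  · refine iSup_le fun ⟨s, _, hs⟩ => ?_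
    have hinj : Set.InjOn rk s := by
      intro a ha b hb hab
      by_contra hne
      rcases hs ha hb hne with h | h
      · exact (hr.strictMono (lt_of_le_of_ne h hne)).ne hab
      · exact (hr.strictMono (lt_of_le_of_ne h (Ne.symm hne))).ne hab.symm
    have h1 : s.encard ≤ (Set.Iic l).encard :=
      Set.encard_le_encard_of_injOn (fun v _ => hl v) hinj
    have h2 : (Set.Iic l).encard = (l : ℕ∞) + 1 := by
      rw [Set.encard_eq_coe_toFinset_card]
      simp
    exact h1.trans h2.le
  · have key : ∀ v : V, ∃ s : Set V, IsChain (· ≤ ·) s ∧ (∀ x ∈ s, x ≤ v) ∧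
        s.encard = (rk v : ℕ∞) + 1 := by
      intro v
      induction v using WellFoundedLT.induction with
      | ind v ih =>
        by_cases hv : rk v = 0
        · exact ⟨{v}, IsChain.singleton, by simp, by simp [hv]⟩
        · obtain ⟨c, hc⟩ := hr.exists_covBy_of_rank_ne_zero hv
          obtain ⟨s, hs, hsc, hcard⟩ := ih c hc.lt
          refine ⟨insert v s, hs.insert fun x hx _ => Or.inr ((hsc x hx).trans hc.le), ?_, ?_⟩
          · rintro x (rfl | hx)
            · exact le_rfl
            · exact (hsc x hx).trans hc.le
          · rw [Set.encard_insert_of_notMem fun h => (hc.lt.trans_le (hsc v h)).false, hcard,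
              hr.covBy _ _ hc]
            simp
    obtain ⟨s, hs, -, hcard⟩ := key t
    rw [← ht, ← hcard]
    exact Set.encard_le_chainHeight_of_isChain _ _ (Set.subset_univ s) hs

/-- A vertex `w` incomparable to both `x` and `z` has rank exactly `rk x + 1 = rk z - 1`. Being
up-seeing or down-seeing, it is then comparable to `z` or to `x`. -/
theorem Vigilant.avoidsThreePlusOne (hv : Vigilant rk) (hr : IsRankFunction rk)
    (h2 : ∀ a b, rk a + 2 ≤ rk b → a < b) : AvoidsThreePlusOne V := by
  rintro ⟨x, y, z, w, hxy, hyz, ⟨hwx, hxw⟩, -, hwz, hzw⟩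
  have h3 := hr.strictMono hxy
  have h4 := hr.strictMono hyz
  have h5 : ¬ rk w + 2 ≤ rk z := fun h => hwz (h2 _ _ h).le
  have h6 : ¬ rk x + 2 ≤ rk w := fun h => hxw (h2 _ _ h).le
  rcases hv w with h | h
  · exact hwz (h z (by omega)).le
  · exact hxw (h x (by omega)).le

end RankTheory

/-- An order isomorphism transports strong gradedness. -/
theorem IsStronglyGraded.comp_orderIso {V W : Type*} [PartialOrder V] [PartialOrder W]
    [Finite W] {rk : W → ℕ} (hr : IsStronglyGraded rk) (e : V ≃o W) :
    IsStronglyGraded (rk ∘ e) where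
  covBy a b h := hr.covBy _ _ ((apply_covBy_apply_iff e).2 h)
  component a := by
    obtain ⟨b, hb, h0⟩ := hr.component (e a)
    refine ⟨e.symm b, ?_, by simpa using h0⟩
    let f : SimpleGraph.hasse W →g SimpleGraph.hasse V :=
      ⟨e.symm, fun {x y} h => by
        simpa only [SimpleGraph.hasse_adj, apply_covBy_apply_iff] using h⟩
    have h := hb.map f
    change (SimpleGraph.hasse V).Reachable (e.symm (e a)) (e.symm b) at h
    rwa [e.symm_apply_apply] at h
  isMin a b ha hb := hr.isMin _ _ ((OrderIso.isMin_apply e).2 ha) ((OrderIso.isMin_apply e).2 hb)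
  isMax a b ha hb := hr.isMax _ _ ((OrderIso.isMax_apply e).2 ha) ((OrderIso.isMax_apply e).2 hb)

/-! ### Orders prescribed by a relation between adjacent ranks -/

section Ladder

variable {V : Type*}

/-- The order in which elements whose ranks differ by at least two are always comparable, and
elements of adjacent ranks are compared by `E`. -/
@[reducible] def ladderOrder (rk : V → ℕ) (E : V → V → Prop) : PartialOrder V where
  le a b := a = b ∨ rk a + 2 ≤ rk b ∨ (rk b = rk a + 1 ∧ E a b)
  le_refl a := Or.inl rfl
  le_trans a b c := by
    rintro (rfl | h | h) (rfl | h' | h')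
    · exact Or.inl rfl
    · exact Or.inr (Or.inl h')
    · exact Or.inr (Or.inr h')
    · exact Or.inr (Or.inl h)
    all_goals first | exact Or.inr (Or.inr h) | exact Or.inr (Or.inl (by omega))
  le_antisymm a b := by
    rintro (rfl | h | h) (h' | h' | h')
    all_goals first | rfl | exact h'.symm | omega

/-- The conditions under which `ladderOrder rk E` is strongly graded with rank function `rk`
and maximal rank `l`. -/
structure IsLadder (rk : V → ℕ) (E : V → V → Prop) (l : ℕ) : Prop where
  rank_le : ∀ v, rk v ≤ l
  down : ∀ v, rk v ≠ 0 → ∃ u, rk u + 1 = rk v ∧ E u v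
  up : ∀ v, rk v ≠ l → ∃ w, rk w = rk v + 1 ∧ E v w
  between : ∀ u w, rk w = rk u + 2 → ∃ v, rk v = rk u + 1 ∧ E u v ∧ E v w

variable {rk : V → ℕ} {E : V → V → Prop} {l : ℕ}

theorem ladderOrder_lt_iff {a b : V} :
    (ladderOrder rk E).lt a b ↔ rk a + 2 ≤ rk b ∨ (rk b = rk a + 1 ∧ E a b) := by
  let _ := ladderOrder rk E
  change a < b ↔ _
  rw [lt_iff_le_and_ne]
  change (a = b ∨ _) ∧ _ ↔ _
  constructor
  · rintro ⟨h | h, h'⟩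
    · exact absurd h h'
    · exact h
  · intro h
    refine ⟨Or.inr h, ?_⟩
    rintro rfl
    omega

/-- Relations across exactly two ranks are refined by `between`, and longer ones by `up`, so neither
kind is a cover. -/
theorem IsLadder.covBy_iff (h : IsLadder rk E l) {a b : V} :
    letI := ladderOrder rk E
    a ⋖ b ↔ rk b = rk a + 1 ∧ E a b := by
  let _ := ladderOrder rk E
  constructor
  · rintro ⟨hab, hmin⟩
    have key : ∀ c, ((ladderOrder rk E).lt a c) → ¬ ((ladderOrder rk E).lt c b) :=
      fun c => @hmin c
    simp only [ladderOrder_lt_iff] at key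
    rcases ladderOrder_lt_iff.1 hab with h1 | h1
    · exfalso
      rcases h1.eq_or_lt with h2 | h2
      · obtain ⟨v, hv, h3, h4⟩ := h.between a b h2.symm
        exact key v (Or.inr ⟨hv, h3⟩) (Or.inr ⟨by omega, h4⟩)
      · obtain ⟨v, hv, h3⟩ := h.up a (by have := h.rank_le b; omega)
        exact key v (Or.inr ⟨hv, h3⟩) (Or.inl (by omega))
    · exact h1
  · intro h1
    refine ⟨ladderOrder_lt_iff.2 (Or.inr h1), fun c hac hcb => ?_⟩
    have h2 := ladderOrder_lt_iff.1 hac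
    have h3 := ladderOrder_lt_iff.1 hcb
    omega

theorem IsLadder.isStronglyGraded (h : IsLadder rk E l) :
    @IsStronglyGraded V (ladderOrder rk E) rk := by
  let _ := ladderOrder rk E
  have h0 : ∀ a : V, IsMin a → rk a = 0 := by
    intro a ha
    by_contra hne
    obtain ⟨u, hu, hE⟩ := h.down a hne
    exact (ladderOrder_lt_iff.2 (Or.inr ⟨hu.symm, hE⟩)).not_ge
      (ha (ladderOrder_lt_iff.2 (Or.inr ⟨hu.symm, hE⟩)).le)
  have hl : ∀ a : V, IsMax a → rk a = l := by
    intro a ha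
    by_contra hne
    obtain ⟨u, hu, hE⟩ := h.up a hne
    exact (ladderOrder_lt_iff.2 (Or.inr ⟨hu, hE⟩)).not_ge
      (ha (ladderOrder_lt_iff.2 (Or.inr ⟨hu, hE⟩)).le)
  refine { covBy := fun a b hab => (h.covBy_iff.1 hab).1, component := ?_, isMin := ?_,
           isMax := ?_ }
  · intro a
    induction hk : rk a generalizing a with
    | zero => exact ⟨a, SimpleGraph.Reachable.refl a, hk⟩
    | succ k ih =>
      obtain ⟨u, hu, hE⟩ := h.down a (by omega)
      obtain ⟨b, hb, hb0⟩ := ih u (by omega)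
      refine ⟨b, SimpleGraph.Reachable.trans (SimpleGraph.Adj.reachable ?_) hb, hb0⟩
      rw [SimpleGraph.hasse_adj]
      exact Or.inr (h.covBy_iff.2 ⟨hu.symm, hE⟩)
  · intro a b ha hb
    rw [h0 a ha, h0 b hb]
  · intro a b ha hb
    rw [hl a ha, hl b hb]

theorem IsLadder.upSeeing_iff (h : IsLadder rk E l) {v : V} :
    @UpSeeing V (ladderOrder rk E) rk v ↔ ∀ w, rk w = rk v + 1 → E v w := by
  refine forall_congr' fun w => forall_congr' fun hw => ?_
  rw [h.covBy_iff]
  exact and_iff_right hw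

theorem IsLadder.downSeeing_iff (h : IsLadder rk E l) {v : V} :
    @DownSeeing V (ladderOrder rk E) rk v ↔ ∀ u, rk u + 1 = rk v → E u v := by
  refine forall_congr' fun w => forall_congr' fun hw => ?_
  rw [h.covBy_iff]
  exact and_iff_right hw.symm

end Ladder

/-! ### Configurations of quarks and the posets they describe -/

section Config

/-- The bipartite graphs between `α` and `β`, both nonempty, with no all-seeing vertex and with
the restrictions `w.1` and `w.2` on the isolated vertices of the upper part `β` and of the lower
part `α`. -/
def quarkSet (α β : Type*) (w : Mark × Mark) : Set (α → β → Prop) :=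
  {G | Nonempty α ∧ (¬ ∃ a, ∀ b, G a b) ∧ (¬ ∃ b, ∀ a, G a b) ∧
    w.1.Holds (fun b => ∀ a, ¬ G a b) ∧ w.2.Holds (fun a => ∀ b, ¬ G a b)}

theorem Mark.Holds.unique {α : Type*} {p : α → Prop} {m m' : Mark} (h : m.Holds p)
    (h' : m'.Holds p) : m = m' := by
  cases m <;> cases m' <;> first | rfl | exact absurd h h' | exact absurd h' h

theorem Mark.exists_holds {α : Type*} (p : α → Prop) : ∃ m : Mark, m.Holds p := by
  by_cases h : ∃ a, p a
  · exact ⟨.circ, h⟩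
  · exact ⟨.otimes, h⟩

theorem quarkSet_mark_unique {α β : Type*} {w w' : Mark × Mark} {G : α → β → Prop}
    (h : G ∈ quarkSet α β w) (h' : G ∈ quarkSet α β w') : w = w' :=
  Prod.ext (h.2.2.2.1.unique h'.2.2.2.1) (h.2.2.2.2.unique h'.2.2.2.2)

/-- An all-seeing vertex is needed in rank `j` of a poset whose quarks carry the marks `w`. -/
def Needed {l : ℕ} (w : Fin l → Mark × Mark) (j : Fin (l + 1)) : Prop :=
  (∀ i : Fin l, i.succ = j → (w i).2 = .circ) ∧ (∀ i : Fin l, i.castSucc = j → (w i).1 = .circ)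

/-- The data determining a sum-indecomposable poset with ranks `0, …, l`: the quark and the side
of every labeled vertex (`true` for the upper side), the quarks, their marks, and the set of
ranks in which there is an all-seeing vertex. -/
structure Config (l n r : ℕ) where
  mark : Fin l → Mark × Mark
  side : Fin n → Fin l × Bool
  adj : ∀ i, {a // side a = (i, false)} → {b // side b = (i, true)} → Prop
  seers : Finset (Fin (l + 1))
  adj_mem : ∀ i, adj i ∈ quarkSet _ _ (mark i)
  mem_seers : ∀ j, Needed mark j → j ∈ seers
  card_seers : seers.card = r

variable {l n r : ℕ}

namespace Config

variable (C : Config l n r)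

/-- The rank of a vertex. -/
def rank : Vertex n r → ℕ
  | .labeled a => (C.side a).1 + (if (C.side a).2 then 1 else 0)
  | .unlabeled j => (C.seers.orderEmbOfFin C.card_seers j : Fin (l + 1))

/-- The up-seeing vertices. -/
def Up : Vertex n r → Prop
  | .labeled a => (C.side a).2 = true
  | .unlabeled _ => True

/-- The down-seeing vertices. -/
def Down : Vertex n r → Prop
  | .labeled a => (C.side a).2 = false
  | .unlabeled _ => True

/-- The covering relation between vertices of adjacent ranks. -/
def Edge (u v : Vertex n r) : Prop :=
  C.Up u ∨ C.Down v ∨ ∃ (i : Fin l) (a : {a // C.side a = (i, false)})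
    (b : {b // C.side b = (i, true)}), u = .labeled a.1 ∧ v = .labeled b.1 ∧ C.adj i a b

variable {C}

theorem up_or_down (v : Vertex n r) : C.Up v ∨ C.Down v := by
  cases v with
  | labeled a => simp only [Up, Down]; cases (C.side a).2 <;> simp
  | unlabeled j => exact Or.inl trivial

theorem exists_of_not_up {v : Vertex n r} (h : ¬ C.Up v) :
    ∃ (i : Fin l) (a : {a // C.side a = (i, false)}), v = .labeled a.1 := by
  cases v with
  | labeled a =>
    refine ⟨(C.side a).1, ⟨a, Prod.ext rfl ?_⟩, rfl⟩
    simpa [Up] using h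
  | unlabeled j => exact absurd trivial h

theorem exists_of_not_down {v : Vertex n r} (h : ¬ C.Down v) :
    ∃ (i : Fin l) (b : {b // C.side b = (i, true)}), v = .labeled b.1 := by
  cases v with
  | labeled a =>
    refine ⟨(C.side a).1, ⟨a, Prod.ext rfl ?_⟩, rfl⟩
    simpa [Down] using h
  | unlabeled j => exact absurd trivial h

theorem rank_lower {i : Fin l} (a : {a // C.side a = (i, false)}) :
    C.rank (.labeled a.1) = i := by
  simp [rank, a.2]

theorem rank_upper {i : Fin l} (b : {b // C.side b = (i, true)}) :
    C.rank (.labeled b.1) = i + 1 := by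
  simp [rank, b.2]

theorem not_up_lower {i : Fin l} (a : {a // C.side a = (i, false)}) :
    ¬ C.Up (.labeled a.1) := by
  simp [Up, a.2]

theorem down_lower {i : Fin l} (a : {a // C.side a = (i, false)}) :
    C.Down (.labeled a.1) := by
  simp [Down, a.2]

theorem up_upper {i : Fin l} (b : {b // C.side b = (i, true)}) :
    C.Up (.labeled b.1) := by
  simp [Up, b.2]

theorem not_down_upper {i : Fin l} (b : {b // C.side b = (i, true)}) :
    ¬ C.Down (.labeled b.1) := by
  simp [Down, b.2]

theorem edge_iff {i : Fin l} (a : {a // C.side a = (i, false)})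
    (b : {b // C.side b = (i, true)}) :
    C.Edge (.labeled a.1) (.labeled b.1) ↔ C.adj i a b := by
  constructor
  · rintro (h | h | ⟨i', a', b', ha, hb, h⟩)
    · exact absurd h (not_up_lower a)
    · exact absurd h (not_down_upper b)
    · obtain ⟨a, ha1⟩ := a
      obtain ⟨b, hb1⟩ := b
      obtain ⟨a', ha2⟩ := a'
      obtain ⟨b', hb2⟩ := b'
      obtain rfl : a = a' := by simpa using ha
      obtain rfl : b = b' := by simpa using hb
      obtain rfl : i = i' := congrArg Prod.fst (ha1.symm.trans ha2)
      exact h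
  · exact fun h => Or.inr (Or.inr ⟨i, a, b, rfl, rfl, h⟩)

theorem exists_lower (C : Config l n r) (i : Fin l) : Nonempty {a // C.side a = (i, false)} :=
  (C.adj_mem i).1

theorem exists_not_adj (a₀ : {a // C.side a = (i, false)}) : ∃ b, ¬ C.adj i a₀ b := by
  by_contra! h
  exact (C.adj_mem i).2.1 ⟨a₀, h⟩

theorem exists_not_adj' (b₀ : {b // C.side b = (i, true)}) : ∃ a, ¬ C.adj i a b₀ := by
  by_contra! h
  exact (C.adj_mem i).2.2.1 ⟨b₀, h⟩

theorem exists_upper (C : Config l n r) (i : Fin l) : Nonempty {b // C.side b = (i, true)} := by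
  obtain ⟨a⟩ := C.exists_lower i
  obtain ⟨b, -⟩ := exists_not_adj a
  exact ⟨b⟩

theorem rank_le (v : Vertex n r) : C.rank v ≤ l := by
  by_cases h : C.Up v
  · by_cases h' : C.Down v
    · cases v with
      | labeled a => simp [Up, Down] at h h'; simp [h] at h'
      | unlabeled j => simp only [rank]; omega
    · obtain ⟨i, b, rfl⟩ := exists_of_not_down h'
      rw [rank_upper]
      omega
  · obtain ⟨i, a, rfl⟩ := exists_of_not_up h
    rw [rank_lower]
    omega

theorem exists_rank_unlabeled {j : Fin (l + 1)} (hj : j ∈ C.seers) :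
    ∃ k : Fin r, C.rank (.unlabeled k) = j := by
  have : j ∈ Set.range (C.seers.orderEmbOfFin C.card_seers) := by
    rwa [Finset.range_orderEmbOfFin]
  obtain ⟨k, hk⟩ := this
  exact ⟨k, congrArg Fin.val hk⟩

theorem mem_seers_of_rank_eq {j : Fin (l + 1)} {k : Fin r}
    (h : C.rank (.unlabeled k) = j) : j ∈ C.seers := by
  obtain rfl : C.seers.orderEmbOfFin C.card_seers k = j := Fin.ext h
  exact Finset.orderEmbOfFin_mem _ _ _

/-- The critical case is an isolated upper vertex of a quark. It lies above the upper vertices of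
the preceding quark, which are up-seeing; for the lowest quark its mark forces an all-seeing vertex
in rank `0`. -/
theorem exists_down (v : Vertex n r) (hv : C.rank v ≠ 0) :
    ∃ u, C.rank u + 1 = C.rank v ∧ C.Edge u v := by
  by_cases h : C.Down v
  · have := rank_le (C := C) v
    obtain ⟨a⟩ := C.exists_lower ⟨C.rank v - 1, by omega⟩
    refine ⟨.labeled a.1, ?_, Or.inr (Or.inl h)⟩
    rw [rank_lower]
    simp only
    omega
  · obtain ⟨i, b, rfl⟩ := exists_of_not_down h
    rw [rank_upper]
    by_cases hiso : ∃ a, C.adj i a b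
    · obtain ⟨a, ha⟩ := hiso
      exact ⟨.labeled a.1, by rw [rank_lower], (edge_iff a b).2 ha⟩
    · push Not at hiso
      obtain ⟨i, hi⟩ := i
      cases i with
      | succ i =>
        obtain ⟨b'⟩ := C.exists_upper ⟨i, by omega⟩
        exact ⟨.labeled b'.1, by rw [rank_upper], Or.inl (up_upper b')⟩
      | zero =>
        have hmark : (C.mark ⟨0, hi⟩).1 = .circ :=
          (C.adj_mem ⟨0, hi⟩).2.2.2.1.unique (m' := .circ) ⟨b, hiso⟩
        obtain ⟨k, hk⟩ := exists_rank_unlabeled (C.mem_seers 0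
          ⟨fun i h => absurd h (Fin.succ_ne_zero i), fun i h => by
            obtain rfl : i = ⟨0, hi⟩ := Fin.ext (by simpa using congrArg Fin.val h)
            exact hmark⟩)
        exact ⟨.unlabeled k, by rw [hk]; rfl, Or.inl trivial⟩

theorem exists_up (v : Vertex n r) (hv : C.rank v ≠ l) :
    ∃ w, C.rank w = C.rank v + 1 ∧ C.Edge v w := by
  have hle := rank_le (C := C) v
  by_cases h : C.Up v
  · obtain ⟨b⟩ := C.exists_upper ⟨C.rank v, by omega⟩
    refine ⟨.labeled b.1, ?_, Or.inl h⟩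
    rw [rank_upper]
  · obtain ⟨i, a, rfl⟩ := exists_of_not_up h
    rw [rank_lower]
    by_cases hiso : ∃ b, C.adj i a b
    · obtain ⟨b, hb⟩ := hiso
      exact ⟨.labeled b.1, by rw [rank_upper], (edge_iff a b).2 hb⟩
    · push Not at hiso
      by_cases hi : (i : ℕ) + 1 < l
      · obtain ⟨a'⟩ := C.exists_lower ⟨i + 1, hi⟩
        exact ⟨.labeled a'.1, by rw [rank_lower], Or.inr (Or.inl (down_lower a'))⟩
      · have hmark : (C.mark i).2 = .circ :=
          (C.adj_mem i).2.2.2.2.unique (m' := .circ) ⟨a, hiso⟩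
        obtain ⟨k, hk⟩ := exists_rank_unlabeled (C.mem_seers i.succ
          ⟨fun i' h => by
            obtain rfl := Fin.succ_injective _ h
            exact hmark, fun i' h => by
            have := congrArg Fin.val h
            simp only [Fin.val_castSucc, Fin.val_succ] at this
            omega⟩)
        exact ⟨.unlabeled k, by rw [hk]; rfl, Or.inr (Or.inl trivial)⟩

/-- An all-seeing vertex in the middle rank settles the claim. Otherwise that rank is not `Needed`,
so one adjacent quark has no isolated vertex on its far side. The endpoint on that side, if it
belongs to this quark, has a neighbour there, and this neighbour sees the other endpoint. -/
theorem exists_between (u x : Vertex n r) (h : C.rank x = C.rank u + 2) :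
    ∃ v, C.rank v = C.rank u + 1 ∧ C.Edge u v ∧ C.Edge v x := by
  have hle := rank_le (C := C) x
  by_cases hj : (⟨C.rank u + 1, by omega⟩ : Fin (l + 1)) ∈ C.seers
  · obtain ⟨k, hk⟩ := exists_rank_unlabeled hj
    exact ⟨.unlabeled k, hk, Or.inr (Or.inl trivial), Or.inl trivial⟩
  · have hn := mt (C.mem_seers _) hj
    rw [Needed, not_and_or] at hn
    push Not at hn
    rcases hn with ⟨i, hi, hm⟩ | ⟨i, hi, hm⟩
    · have hi : (i : ℕ) + 1 = C.rank u + 1 := congrArg Fin.val hi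
      by_cases hu : C.Up u
      · obtain ⟨v, hv, hE⟩ := exists_down (C := C) x (by omega)
        exact ⟨v, by omega, Or.inl hu, hE⟩
      · obtain ⟨i', a, rfl⟩ := exists_of_not_up hu
        rw [rank_lower] at hi h ⊢
        obtain rfl : i = i' := Fin.ext (by omega)
        by_cases hiso : ∃ b, C.adj i a b
        · obtain ⟨b, hb⟩ := hiso
          exact ⟨.labeled b.1, by rw [rank_upper], (edge_iff a b).2 hb, Or.inl (up_upper b)⟩
        · push Not at hiso
          exact absurd ((C.adj_mem i).2.2.2.2.unique (m' := .circ) ⟨a, hiso⟩) hm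
    · have hi : (i : ℕ) = C.rank u + 1 := congrArg Fin.val hi
      by_cases hx : C.Down x
      · obtain ⟨v, hv, hE⟩ := exists_up (C := C) u (by omega)
        exact ⟨v, hv, hE, Or.inr (Or.inl hx)⟩
      · obtain ⟨i', b, rfl⟩ := exists_of_not_down hx
        rw [rank_upper] at h
        obtain rfl : i = i' := Fin.ext (by omega)
        by_cases hiso : ∃ a, C.adj i a b
        · obtain ⟨a, ha⟩ := hiso
          exact ⟨.labeled a.1, by rw [rank_lower]; omega, Or.inr (Or.inl (down_lower a)),
            (edge_iff a b).2 ha⟩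
        · push Not at hiso
          exact absurd ((C.adj_mem i).2.2.2.1.unique (m' := .circ) ⟨b, hiso⟩) hm

theorem isLadder (C : Config l n r) : IsLadder C.rank C.Edge l :=
  ⟨rank_le, exists_down, exists_up, exists_between⟩

/-- The poset described by a configuration. -/
@[reducible] def order (C : Config l n r) : PartialOrder (Vertex n r) :=
  ladderOrder C.rank C.Edge

theorem upSeeing_iff {v : Vertex n r} : @UpSeeing _ C.order C.rank v ↔ C.Up v := by
  rw [C.isLadder.upSeeing_iff]
  refine ⟨fun h => ?_, fun h w _ => Or.inl h⟩
  by_contra hu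
  obtain ⟨i, a, rfl⟩ := exists_of_not_up hu
  obtain ⟨b, hb⟩ := exists_not_adj a
  exact hb ((edge_iff a b).1 (h _ (by rw [rank_upper, rank_lower])))

theorem downSeeing_iff {v : Vertex n r} : @DownSeeing _ C.order C.rank v ↔ C.Down v := by
  rw [C.isLadder.downSeeing_iff]
  refine ⟨fun h => ?_, fun h w _ => Or.inr (Or.inl h)⟩
  by_contra hu
  obtain ⟨i, b, rfl⟩ := exists_of_not_down hu
  obtain ⟨a, ha⟩ := exists_not_adj' b
  exact ha ((edge_iff a b).1 (h _ (by rw [rank_upper, rank_lower])))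

theorem allSeeing_iff {v : Vertex n r} :
    @AllSeeing _ C.order C.rank v ↔ v ∈ Set.range Vertex.unlabeled := by
  let _ := C.order
  change UpSeeing _ _ ∧ DownSeeing _ _ ↔ _
  rw [upSeeing_iff, downSeeing_iff]
  cases v with
  | labeled a => simp [Up, Down]
  | unlabeled j => simp [Up, Down]

theorem exists_rank_eq_top (C : Config (l + 1) n r) : ∃ v, C.rank v = l + 1 := by
  obtain ⟨b⟩ := C.exists_upper (Fin.last l)
  exact ⟨_, rank_upper b⟩

instance : Finite (Vertex n r) :=
  Finite.of_surjective (Sum.elim Vertex.labeled Vertex.unlabeled : Fin n ⊕ Fin r → Vertex n r)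
    fun v => by
      cases v with
      | labeled i => exact ⟨.inl i, rfl⟩
      | unlabeled j => exact ⟨.inr j, rfl⟩

theorem height_order (C : Config (l + 1) n r) :
    @height _ C.order = ((l + 1 : ℕ) : ℕ∞) + 1 := by
  obtain ⟨v, hv⟩ := C.exists_rank_eq_top
  let _ := C.order
  exact C.isLadder.isStronglyGraded.height_eq rank_le hv

theorem vigilant (C : Config l n r) : @Vigilant _ C.order C.rank := fun v => by
  rw [upSeeing_iff, downSeeing_iff]
  exact up_or_down v

theorem isTrimmed (C : Config l n r) :
    @IsTrimmed _ C.order C.rank (Set.range Vertex.unlabeled) := by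
  let _ := C.order
  refine ⟨C.vigilant, fun v w hv hw h => ?_, fun v => allSeeing_iff.symm⟩
  · rw [allSeeing_iff] at hv hw
    obtain ⟨j, rfl⟩ := hv
    obtain ⟨k, rfl⟩ := hw
    rw [(C.seers.orderEmbOfFin C.card_seers).injective (Fin.ext h)]

/-- The class member described by a configuration. -/
def toStructure (C : Config (l + 1) n r) : IndecStructure n r :=
  ⟨C.order, ⟨by
      obtain ⟨v, -⟩ := C.exists_rank_eq_top
      exact ⟨v⟩, C.rank, C.isLadder.isStronglyGraded, C.isTrimmed, by
      rintro ⟨i, hi, h⟩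
      rw [height_order] at hi
      have hi' : i + 1 < l + 1 + 1 := by exact_mod_cast hi
      obtain ⟨a⟩ := C.exists_lower ⟨i, by omega⟩
      exact not_up_lower a (upSeeing_iff.1 (h _ (rank_lower a)))⟩,
    by
      let _ := C.order
      exact C.vigilant.avoidsThreePlusOne C.isLadder.isStronglyGraded.toIsRankFunction
        fun a b h => ladderOrder_lt_iff.2 (Or.inl h),
    by
      rw [height_order]
      exact_mod_cast (by omega : 2 ≤ l + 1 + 1)⟩

end Config

end Config

/-! ### The bijection between configurations and isomorphism classes -/

variable {l n r : ℕ}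

namespace Config

variable {C : Config l n r}

theorem up_iff {v : Vertex n r} : C.Up v ↔ ∀ w, C.rank w = C.rank v + 1 → C.Edge v w := by
  rw [← upSeeing_iff, C.isLadder.upSeeing_iff]

theorem order_le_iff {u v : Vertex n r} (h : C.rank v = C.rank u + 1) :
    C.order.le u v ↔ C.Edge u v := by
  change (u = v ∨ _) ↔ _
  constructor
  · rintro (rfl | h' | h')
    · omega
    · omega
    · exact h'.2
  · exact fun h' => Or.inr (Or.inr ⟨h, h'⟩)

/-- One lower vertex from each quark gives `l` distinct labels. For fixed `n` this leaves finitely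
many heights. -/
theorem lt_card (C : Config l n r) : l ≤ n := by
  have f := fun i => Classical.choice (C.exists_lower i)
  have hf : Function.Injective fun i => (f i).1 := fun i j hij => by
    have h1 := (f i).2
    rw [show (f i).1 = (f j).1 from hij, (f j).2] at h1
    exact (congrArg Prod.fst h1).symm
  simpa using Fintype.card_le_of_injective _ hf

theorem rank_apply_of_iso {l' : ℕ} {C' : Config l' n r} {e : Vertex n r ≃ Vertex n r}
    (hle : ∀ a b, C.order.le a b ↔ C'.order.le (e a) (e b)) (v : Vertex n r) :
    C'.rank (e v) = C.rank v := by
  let f : @OrderIso _ _ C.order.toLE C'.order.toLE :=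
    @RelIso.mk _ _ C.order.le C'.order.le e fun {a b} => (hle a b).symm
  have h1 := @IsStronglyGraded.comp_orderIso _ _ C.order C'.order _ _
    C'.isLadder.isStronglyGraded f
  exact congrFun (@IsStronglyGraded.eq _ C.order _ _ h1 _ C.isLadder.isStronglyGraded) v

/-- All data can be read off from the order: rank and up-seeing give the side, the ranks of the
unlabeled vertices give the seers, relations between adjacent ranks give the quarks, and the quarks
determine their marks. -/
theorem eq_of_iso {C' : Config l n r} {e : Vertex n r ≃ Vertex n r}
    (hlab : ∀ i : Fin n, e (.labeled i) = .labeled i)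
    (hle : ∀ a b, C.order.le a b ↔ C'.order.le (e a) (e b)) : C = C' := by
  have hrank := rank_apply_of_iso hle
  have hedge : ∀ u v, C.rank v = C.rank u + 1 → (C.Edge u v ↔ C'.Edge (e u) (e v)) := by
    intro u v h
    rw [← order_le_iff h, hle, order_le_iff (by rw [hrank, hrank, h])]
  have hup : ∀ v, C.Up v ↔ C'.Up (e v) := by
    intro v
    rw [up_iff, up_iff]
    constructor
    · intro h w hw
      obtain ⟨w, rfl⟩ := e.surjective w
      rw [hrank, hrank] at hw
      exact (hedge v w hw).1 (h w hw)
    · exact fun h w hw => (hedge v w hw).2 (h _ (by rw [hrank, hrank, hw]))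
  have hunl : ∀ k, ∃ k', e (.unlabeled k) = .unlabeled k' := by
    intro k
    cases h : e (.unlabeled k) with
    | labeled a => exact absurd (e.injective (h.trans (hlab a).symm)) (by simp)
    | unlabeled k' => exact ⟨k', rfl⟩
  have hunl' : ∀ k', ∃ k, e (.unlabeled k) = .unlabeled k' := by
    intro k'
    obtain ⟨v, hv⟩ := e.surjective (.unlabeled k')
    cases v with
    | labeled a => simp [hlab] at hv
    | unlabeled k => exact ⟨k, hv⟩
  have hside : C.side = C'.side := by
    funext a
    have h1 := hup (.labeled a)
    have h2 := hrank (.labeled a)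
    rw [hlab] at h1 h2
    have h3 : (C.side a).2 = (C'.side a).2 := Bool.eq_iff_iff.2 h1
    refine Prod.ext (Fin.ext ?_) h3
    simp only [rank, h3] at h2
    omega
  have hseers : C.seers = C'.seers := by
    ext j
    constructor
    · intro hj
      obtain ⟨k, hk⟩ := exists_rank_unlabeled hj
      obtain ⟨k', hk'⟩ := hunl k
      exact mem_seers_of_rank_eq (k := k') (by rw [← hk', hrank, hk])
    · intro hj
      obtain ⟨k', hk'⟩ := exists_rank_unlabeled hj
      obtain ⟨k, hk⟩ := hunl' k'
      exact mem_seers_of_rank_eq (k := k) (by rw [← hrank, hk, hk'])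
  -- The membership proofs vary freely because they refer to `C.side` on the left and to `C'.side`
  -- on the right; the statement stays usable once the two are identified.
  have hadj : ∀ i a b ha hb ha' hb',
      C.adj i ⟨a, ha⟩ ⟨b, hb⟩ ↔ C'.adj i ⟨a, ha'⟩ ⟨b, hb'⟩ := by
    intro i a b ha hb ha' hb'
    have h := hedge (.labeled a) (.labeled b)
      ((rank_upper ⟨b, hb⟩).trans (by rw [rank_lower ⟨a, ha⟩]))
    rw [hlab, hlab] at h
    exact (edge_iff ⟨a, ha⟩ ⟨b, hb⟩).symm.trans (h.trans (edge_iff ⟨a, ha'⟩ ⟨b, hb'⟩))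
  clear hrank hedge hup hle
  obtain ⟨m, s, G, A, hG, hA, hc⟩ := C
  obtain ⟨m', s', G', A', hG', hA', hc'⟩ := C'
  dsimp only at hside hseers hadj
  subst hside hseers
  obtain rfl : G = G' := by
    funext i a b
    exact propext (hadj i a.1 b.1 a.2 b.2 a.2 b.2)
  obtain rfl : m = m' := funext fun i => quarkSet_mark_unique (hG i) (hG' i)
  rfl

end Config

/-- The permutation of the vertices induced by a permutation of the unlabeled ones. -/
def Vertex.permUnlabeled (t : Fin r ≃ Fin r) : Vertex n r ≃ Vertex n r where
  toFun
    | .labeled i => .labeled i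
    | .unlabeled j => .unlabeled (t j)
  invFun
    | .labeled i => .labeled i
    | .unlabeled j => .unlabeled (t.symm j)
  left_inv v := by cases v <;> simp
  right_inv v := by cases v <;> simp

theorem exists_config [PartialOrder (Vertex n r)]
    (hI : IsSumIndecomposable (Vertex n r) (Set.range Vertex.unlabeled))
    (hA : AvoidsThreePlusOne (Vertex n r)) (hh : 2 ≤ height (Vertex n r)) :
    ∃ (l : ℕ) (C : Config (l + 1) n r) (e : Vertex n r ≃ Vertex n r),
      (∀ i, e (.labeled i) = .labeled i) ∧ ∀ a b, C.order.le a b ↔ e a ≤ e b := by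
  classical
  obtain ⟨hne, rk, hr, ht, hnd⟩ := hI
  obtain ⟨t, htop⟩ := Finite.exists_max rk
  have hheight := hr.height_eq htop rfl
  obtain ⟨l, hl⟩ : ∃ l, rk t = l + 1 := by
    rw [hheight] at hh
    have : 2 ≤ rk t + 1 := by exact_mod_cast hh
    exact ⟨rk t - 1, by omega⟩
  rw [hl] at htop hheight
  have hall : ∀ v, AllSeeing rk v ↔ ∃ j, Vertex.unlabeled j = v :=
    fun v => (ht.mem_unlabeled v).symm
  have hlab : ∀ a, ¬ (UpSeeing rk (Vertex.labeled a : Vertex n r) ∧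
      DownSeeing rk (Vertex.labeled a : Vertex n r)) := fun a h => by
    obtain ⟨j, hj⟩ := (hall _).1 h
    simp at hj
  have hlow : ∀ v, ¬ UpSeeing rk v → ∃ a, v = .labeled a ∧ rk v < l + 1 := by
    intro v hv
    have hlt : rk v < l + 1 := by
      by_contra h
      exact hv fun w hw => by have := htop w; omega
    cases v with
    | labeled a => exact ⟨a, rfl, hlt⟩
    | unlabeled j => exact absurd ((hall _).2 ⟨j, rfl⟩).1 hv
  have hupp : ∀ v, ¬ DownSeeing rk v → ∃ a, v = .labeled a ∧ 1 ≤ rk v := by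
    intro v hv
    have hlt : 1 ≤ rk v := by
      by_contra h
      exact hv fun w hw => by omega
    cases v with
    | labeled a => exact ⟨a, rfl, hlt⟩
    | unlabeled j => exact absurd ((hall _).2 ⟨j, rfl⟩).2 hv
  have hside : ∀ a, ∃ s : Fin (l + 1) × Bool,
      (s.2 = true ↔ UpSeeing rk (Vertex.labeled a : Vertex n r)) ∧
      rk (.labeled a) = s.1 + if s.2 then 1 else 0 := by
    intro a
    by_cases h : UpSeeing rk (Vertex.labeled a : Vertex n r)
    · obtain ⟨-, -, h1⟩ := hupp _ fun h' => hlab a ⟨h, h'⟩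
      have := htop (.labeled a)
      exact ⟨(⟨rk (.labeled a) - 1, by omega⟩, true), by simpa using h, by simp; omega⟩
    · obtain ⟨-, -, h1⟩ := hlow _ h
      exact ⟨(⟨rk (.labeled a), h1⟩, false), by simpa using h, by simp⟩
  choose side hsideU hsideR using hside
  have hfalse : ∀ a i, side a = (i, false) ↔
      ¬ UpSeeing rk (Vertex.labeled a : Vertex n r) ∧ rk (.labeled a) = i := by
    intro a i
    rw [← hsideU, hsideR, Prod.ext_iff, Fin.ext_iff]
    cases (side a).2 <;> simp
  have htrue : ∀ a i, side a = (i, true) ↔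
      UpSeeing rk (Vertex.labeled a : Vertex n r) ∧ rk (.labeled a) = i + 1 := by
    intro a i
    rw [← hsideU, hsideR, Prod.ext_iff, Fin.ext_iff]
    cases (side a).2 <;> simp
  have htrue' : ∀ v, ¬ DownSeeing rk v → ∀ i : Fin (l + 1), rk v = i + 1 →
      ∃ a, v = .labeled a ∧ side a = (i, true) := by
    intro v hv i hi
    obtain ⟨a, rfl, -⟩ := hupp v hv
    exact ⟨a, rfl, (htrue a i).2 ⟨(ht.vigilant _).resolve_right hv, hi⟩⟩
  have hfalse' : ∀ v, ¬ UpSeeing rk v → ∀ i : Fin (l + 1), rk v = i →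
      ∃ a, v = .labeled a ∧ side a = (i, false) := by
    intro v hv i hi
    obtain ⟨a, rfl, -⟩ := hlow v hv
    exact ⟨a, rfl, (hfalse a i).2 ⟨hv, hi⟩⟩
  have hnotdown : ∀ a i, side a = (i, true) →
      ¬ DownSeeing rk (Vertex.labeled a : Vertex n r) :=
    fun a i h h' => hlab a ⟨((htrue a i).1 h).1, h'⟩
  let adj : ∀ i, {a // side a = (i, false)} → {b // side b = (i, true)} → Prop :=
    fun i a b => (Vertex.labeled a.1 : Vertex n r) < .labeled b.1
  have hquark : ∀ i, ∃ w, adj i ∈ quarkSet _ _ w := by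
    intro i
    obtain ⟨ν, hν⟩ := Mark.exists_holds fun b => ∀ a, ¬ adj i a b
    obtain ⟨μ, hμ⟩ := Mark.exists_holds fun a => ∀ b, ¬ adj i a b
    refine ⟨(ν, μ), ?_, ?_, ?_, hν, hμ⟩
    -- With an empty lower part, all vertices of rank `i` would be up-seeing, against
    -- sum-indecomposability.
    · by_contra hemp
      refine hnd ⟨i, ?_, fun v hv => ?_⟩
      · rw [hheight]
        exact_mod_cast (by omega : (i : ℕ) + 1 < l + 1 + 1)
      · by_contra hu
        obtain ⟨a, -, ha⟩ := hfalse' v hu i hv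
        exact hemp ⟨⟨a, ha⟩⟩
    -- A vertex of rank `i + 1` outside the quark is down-seeing, so a lower vertex adjacent to the
    -- whole upper part would be up-seeing.
    · rintro ⟨⟨a, ha⟩, hall'⟩
      obtain ⟨hu, hrk⟩ := (hfalse a i).1 ha
      refine hu fun w hw => hr.covBy_iff.2 ⟨?_, hw⟩
      by_cases hw' : DownSeeing rk w
      · exact (hw' _ hw.symm).lt
      · obtain ⟨b, rfl, hb⟩ := htrue' w hw' i (by omega)
        exact hall' ⟨b, hb⟩
    · rintro ⟨⟨b, hb⟩, hall'⟩
      have hrk := ((htrue b i).1 hb).2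
      refine hnotdown b i hb fun u hu => hr.covBy_iff.2 ⟨?_, hu.symm⟩
      by_cases hu' : UpSeeing rk u
      · exact (hu' _ hu.symm).lt
      · obtain ⟨a, rfl, ha⟩ := hfalse' u hu' i (by omega)
        exact hall' ⟨a, ha⟩
  choose mark hmark using hquark
  let f : Fin r → Fin (l + 2) := fun k => ⟨rk (.unlabeled k), Nat.lt_succ_of_le (htop _)⟩
  have hf : Function.Injective f := fun k k' h => by
    have := ht.allSeeing_unique _ _ ((hall _).2 ⟨k, rfl⟩) ((hall _).2 ⟨k', rfl⟩)
      (congrArg Fin.val h)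
    simpa using this
  have hseer : ∀ v (j : Fin (l + 2)), UpSeeing rk v → DownSeeing rk v → rk v = j →
      j ∈ Finset.univ.image f := by
    intro v j h1 h2 h3
    obtain ⟨k, rfl⟩ := (hall v).1 ⟨h1, h2⟩
    exact Finset.mem_image.2 ⟨k, Finset.mem_univ _, Fin.ext h3⟩
  have hisoU : ∀ i, (mark i).1 = .circ → ∃ b, side b = (i, true) ∧
      ∀ u, ¬ UpSeeing rk u → rk u = i → ¬ u < .labeled b := by
    intro i hi
    have h1 := (hmark i).2.2.2.1
    rw [hi] at h1
    obtain ⟨⟨b, hb⟩, hb'⟩ := h1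
    refine ⟨b, hb, fun u hu hui h => ?_⟩
    obtain ⟨a, rfl, ha⟩ := hfalse' u hu i hui
    exact hb' ⟨a, ha⟩ h
  have hisoD : ∀ i, (mark i).2 = .circ → ∃ a, side a = (i, false) ∧
      ∀ u, ¬ DownSeeing rk u → rk u = i + 1 → ¬ .labeled a < u := by
    intro i hi
    have h1 := (hmark i).2.2.2.2
    rw [hi] at h1
    obtain ⟨⟨a, ha⟩, ha'⟩ := h1
    refine ⟨a, ha, fun u hu hui h => ?_⟩
    obtain ⟨b, rfl, hb⟩ := htrue' u hu i hui
    exact ha' ⟨b, hb⟩ h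
  have hneeded : ∀ j, Needed mark j → j ∈ Finset.univ.image f := by
    rintro j ⟨hjD, hjU⟩
    rcases Fin.eq_zero_or_eq_succ j with rfl | ⟨i, rfl⟩
    · obtain ⟨b, hb, hb'⟩ := hisoU 0 (hjU 0 rfl)
      have hrb := ((htrue b 0).1 hb).2
      obtain ⟨u, hu⟩ := hr.exists_covBy_of_rank_ne_zero (b := .labeled b) (by omega)
      have hru := hr.covBy _ _ hu
      have hru0 : rk u = 0 := by simpa using (hru.symm.trans hrb)
      refine hseer u _ ?_ (fun v hv => by omega) hru0
      by_contra h
      exact hb' u h hru0 hu.lt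
    · obtain ⟨a, ha, ha'⟩ := hisoD i (hjD i rfl)
      have hra := ((hfalse a i).1 ha).2
      rcases Nat.lt_or_ge ((i : ℕ) + 1) (l + 1) with hi | hi
      · obtain ⟨b, hb, hb'⟩ := hisoU ⟨i + 1, hi⟩ (hjU ⟨i + 1, hi⟩ (Fin.ext rfl))
        have hrb := ((htrue b _).1 hb).2
        simp only at hrb
        -- A cover `v` of `a` below `b` must be all-seeing: if not down-seeing it would be a quark
        -- neighbour of `a`, if not up-seeing one of `b`, and both are isolated.
        have hab : Vertex.labeled a < Vertex.labeled b :=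
          hr.lt_of_rank_add_two_le hA (by omega)
        obtain ⟨v, hav, hvb⟩ := exists_covBy_le hab
        have hrv := hr.covBy _ _ hav
        have hvb : v < .labeled b := lt_of_le_of_ne hvb (by rintro rfl; omega)
        refine hseer v i.succ ?_ ?_ (by rw [hrv, hra]; rfl)
        · by_contra h
          exact hb' v h (by simp only; omega) hvb
        · by_contra h
          exact ha' v h (by omega) hav.lt
      · have hnm : ¬ IsMax (Vertex.labeled a : Vertex n r) := by
          rw [hr.isMax_iff htop hl]
          omega
        obtain ⟨w, hw⟩ := not_isMax_iff.1 hnm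
        obtain ⟨v, hav, -⟩ := exists_covBy_le hw
        have hrv := hr.covBy _ _ hav
        refine hseer v i.succ ?_ ?_ (by rw [hrv, hra]; rfl)
        · intro w hw
          have := htop w
          omega
        · by_contra h
          exact ha' v h (by omega) hav.lt
  let C : Config (l + 1) n r :=
    { mark := mark, side := side, adj := adj, seers := Finset.univ.image f, adj_mem := hmark,
      mem_seers := hneeded, card_seers := by rw [Finset.card_image_of_injective _ hf]; simp }
  -- A configuration numbers its all-seeing vertices by increasing rank, the given poset
  -- arbitrarily; `τ` matches them by rank.
  have htau : ∀ k, ∃ k', rk (.unlabeled k') = C.rank (.unlabeled k) := by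
    intro k
    obtain ⟨k', -, hk'⟩ := Finset.mem_image.1 (Finset.orderEmbOfFin_mem C.seers C.card_seers k)
    exact ⟨k', congrArg Fin.val hk'⟩
  choose τ hτ using htau
  have hτi : Function.Injective τ := fun k k' h => by
    have h1 := hτ k
    rw [h, hτ k'] at h1
    exact ((C.seers.orderEmbOfFin C.card_seers).injective (Fin.ext h1)).symm
  let e : Vertex n r ≃ Vertex n r := Vertex.permUnlabeled
    (Equiv.ofBijective τ (Finite.injective_iff_bijective.1 hτi))
  have hrank : ∀ v, rk (e v) = C.rank v := by
    intro v
    cases v with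
    | labeled a => exact hsideR a
    | unlabeled k => exact hτ k
  have hup : ∀ v, C.Up v → UpSeeing rk (e v) := by
    intro v hv
    cases v with
    | labeled a => exact (hsideU a).1 hv
    | unlabeled k => exact ((hall _).2 ⟨_, rfl⟩).1
  have hdown : ∀ v, C.Down v → DownSeeing rk (e v) := by
    intro v hv
    cases v with
    | labeled a =>
      refine (ht.vigilant _).resolve_left fun h => ?_
      have h1 := (hsideU a).2 h
      have h2 : (side a).2 = false := hv
      simp [h1] at h2
    | unlabeled k => exact ((hall _).2 ⟨_, rfl⟩).2
  have hedge : ∀ u v, C.rank v = C.rank u + 1 → (C.Edge u v ↔ e u < e v) := by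
    intro u v huv
    by_cases hu : C.Up u
    · exact iff_of_true (Or.inl hu) (hup u hu _ (by rw [hrank, hrank, huv])).lt
    by_cases hv : C.Down v
    · exact iff_of_true (Or.inr (Or.inl hv)) (hdown v hv _ (by rw [hrank, hrank, huv])).lt
    obtain ⟨i, a, rfl⟩ := Config.exists_of_not_up hu
    obtain ⟨i', b, rfl⟩ := Config.exists_of_not_down hv
    rw [Config.rank_upper, Config.rank_lower] at huv
    obtain rfl : i' = i := Fin.ext (by omega)
    exact Config.edge_iff a b
  refine ⟨l, C, e, fun i => rfl, fun u v => ?_⟩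
  rw [le_iff_eq_or_lt, e.apply_eq_iff_eq]
  change (u = v ∨ _) ↔ _
  refine or_congr_right ⟨?_, fun h => ?_⟩
  · rintro (h | ⟨h, h'⟩)
    · exact hr.lt_of_rank_add_two_le hA (by rwa [hrank, hrank])
    · exact (hedge u v h).1 h'
  · have h1 := hr.strictMono h
    rw [hrank, hrank] at h1
    by_cases h2 : C.rank v = C.rank u + 1
    · exact Or.inr ⟨h2, (hedge u v h2).2 h⟩
    · exact Or.inl (by omega)

/-- The isomorphism class of the poset described by a configuration. -/
def configClass (n r : ℕ) (x : Σ l : Fin n, Config (l + 1) n r) :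
    Quotient (labelIsoSetoid n r) :=
  ⟦x.2.toStructure⟧

theorem configClass_bijective (n r : ℕ) : Function.Bijective (configClass n r) := by
  constructor
  · rintro ⟨⟨l, hl⟩, C⟩ ⟨⟨l', hl'⟩, C'⟩ h
    obtain ⟨e, hlab, hle⟩ : LabelIso C.toStructure C'.toStructure := Quotient.exact h
    have hrank := Config.rank_apply_of_iso (C := C) (C' := C') hle
    obtain rfl : l = l' := by
      obtain ⟨v, hv⟩ := C.exists_rank_eq_top
      obtain ⟨v', hv'⟩ := C'.exists_rank_eq_top
      have h1 := Config.rank_le (C := C') (e v)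
      have h2 := Config.rank_le (C := C) (e.symm v')
      rw [← hrank, e.apply_symm_apply] at h2
      rw [hrank] at h1
      dsimp only at hv hv' h1 h2
      omega
    rw [Config.eq_of_iso (C := C) (C' := C') hlab hle]
  · intro q
    induction q using Quotient.inductionOn with
    | h P =>
      obtain ⟨l, C, e, hlab, hle⟩ := @exists_config n r P.1 P.2.1 P.2.2.1 P.2.2.2
      exact ⟨⟨⟨l, C.lt_card⟩, C⟩, Quotient.sound ⟨e, hlab, hle⟩⟩

/-! ### Products of exponential generating functions -/

section FiberCounting

variable {κ : Type*} [Fintype κ] [DecidableEq κ]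

/-- The number of functions with prescribed fiber sizes is a multinomial coefficient. -/
theorem card_filter_card_fiber_eq {n : ℕ} {s : κ → ℕ} (hs : ∑ k, s k = n) :
    (Finset.univ.filter fun c : Fin n → κ =>
      (fun k => (Finset.univ.filter fun a => c a = k).card) = s).card =
      Nat.multinomial Finset.univ s := by
  have key : ∀ x : κ → ℕ, (∏ k, (MvPolynomial.X k : MvPolynomial κ ℕ) ^ x k) =
      MvPolynomial.monomial (Finsupp.equivFunOnFinite.symm x) 1 := by
    intro x
    rw [MvPolynomial.monomial_eq, Finsupp.prod_fintype _ _ (by simp)]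
    simp
  -- The `n`-th power of the sum of the variables is expanded once over functions `Fin n → κ` and
  -- once by the multinomial theorem; the coefficients at `s` are compared.
  have h1 := Finset.sum_pow_eq_sum_piAntidiag (Finset.univ : Finset κ)
    (fun k => (MvPolynomial.X k : MvPolynomial κ ℕ)) n
  rw [Fintype.sum_pow] at h1
  have h2 := congrArg (MvPolynomial.coeff (Finsupp.equivFunOnFinite.symm s)) h1
  have h3 : ∀ c : Fin n → κ, (∏ a, (MvPolynomial.X (c a) : MvPolynomial κ ℕ)) =
      ∏ k, (MvPolynomial.X k : MvPolynomial κ ℕ) ^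
        (Finset.univ.filter fun a => c a = k).card := fun c => by
    rw [← Finset.prod_fiberwise (s := Finset.univ) (g := c)]
    refine Finset.prod_congr rfl fun k _ => ?_
    rw [Finset.prod_congr rfl (g := fun _ => MvPolynomial.X k)
      (fun a ha => by rw [(Finset.mem_filter.1 ha).2]), Finset.prod_const]
  simp only [h3, key, MvPolynomial.coeff_sum, MvPolynomial.coeff_monomial,
    ← MvPolynomial.C_eq_coe_nat, MvPolynomial.coeff_C_mul, EmbeddingLike.apply_eq_iff_eq] at h2
  rw [Finset.card_filter, h2, Finset.sum_eq_single s]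
  · simp
  · intro b _ hb
    simp [hb]
  · intro h
    exact absurd (Finset.mem_piAntidiag.2 ⟨hs, by simp⟩) h

theorem sum_fiber_card {n : ℕ} (Φ : (κ → ℕ) → ℝ) :
    ∑ c : Fin n → κ, Φ (fun k => (Finset.univ.filter fun a => c a = k).card) =
      ∑ s ∈ Finset.piAntidiag (Finset.univ : Finset κ) n,
        (Nat.multinomial Finset.univ s : ℝ) * Φ s := by
  rw [← Finset.sum_fiberwise_of_maps_to (s := Finset.univ)
    (t := Finset.piAntidiag (Finset.univ : Finset κ) n)
    (g := fun c : Fin n → κ => fun k => (Finset.univ.filter fun a => c a = k).card)]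
  · refine Finset.sum_congr rfl fun s hs => ?_
    rw [Finset.sum_congr rfl (g := fun _ => Φ s)
      (fun a ha => by rw [(Finset.mem_filter.1 ha).2]), Finset.sum_const,
      card_filter_card_fiber_eq (Finset.mem_piAntidiag.1 hs).1, nsmul_eq_mul]
  · intro c _
    rw [Finset.mem_piAntidiag]
    refine ⟨?_, by simp⟩
    have := Finset.card_eq_sum_card_fiberwise (f := c) (s := Finset.univ) (t := Finset.univ)
      (by simp [Set.MapsTo])
    simpa using this.symm

/-- Choosing sizes for all pairs `(i, b)` amounts to choosing a total size for each `i` and then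
splitting it in two. -/
theorem sum_piAntidiag_eq_coeff_prod {ι : Type*} [Fintype ι] [DecidableEq ι]
    (u : ι → ℕ × ℕ → ℝ) (n : ℕ) :
    ∑ s ∈ Finset.piAntidiag (Finset.univ : Finset (ι × Bool)) n,
      ∏ i, u i (s (i, false), s (i, true)) =
    PowerSeries.coeff n (∏ i, PowerSeries.mk fun N =>
      ∑ p ∈ Finset.HasAntidiagonal.antidiagonal N, u i p) := by
  rw [PowerSeries.coeff_prod]
  simp only [PowerSeries.coeff_mk, Finset.prod_univ_sum]
  rw [Finset.sum_sigma']
  refine Finset.sum_bij'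
    (fun s _ => ⟨Finsupp.equivFunOnFinite.symm fun i => s (i, false) + s (i, true),
      fun i => (s (i, false), s (i, true))⟩)
    (fun x _ k => if k.2 then (x.2 k.1).2 else (x.2 k.1).1) ?_ ?_ ?_ ?_ ?_
  · intro s hs
    simp only [Finset.mem_piAntidiag, Fintype.sum_prod_type, Fintype.sum_bool] at hs
    simp only [Finset.mem_sigma, Finset.mem_finsuppAntidiag, Fintype.mem_piFinset,
      Finset.HasAntidiagonal.mem_antidiagonal]
    refine ⟨⟨?_, Finset.subset_univ _⟩, fun i => rfl⟩
    rw [← hs.1]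
    exact Finset.sum_congr rfl fun i _ => add_comm _ _
  · rintro ⟨t, p⟩ h
    simp only [Finset.mem_sigma, Finset.mem_finsuppAntidiag, Fintype.mem_piFinset,
      Finset.HasAntidiagonal.mem_antidiagonal] at h
    simp only [Finset.mem_piAntidiag, Fintype.sum_prod_type, Fintype.sum_bool]
    refine ⟨?_, by simp⟩
    rw [← h.1.1]
    refine Finset.sum_congr rfl fun i _ => ?_
    rw [← h.2 i]
    simp [add_comm]
  · intro s _
    funext ⟨i, b⟩
    cases b <;> rfl
  · rintro ⟨t, p⟩ h
    simp only [Finset.mem_sigma, Finset.mem_finsuppAntidiag, Fintype.mem_piFinset,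
      Finset.HasAntidiagonal.mem_antidiagonal] at h
    obtain rfl : t = Finsupp.equivFunOnFinite.symm fun i => (p i).1 + (p i).2 := by
      ext i
      exact (h.2 i).symm
    rfl
  · intro s _
    rfl

/-- The product formula for exponential generating functions in which every factor is a double
exponential generating function evaluated on the diagonal. -/
theorem sum_prod_fiber_card {ι : Type*} [Fintype ι] [DecidableEq ι] (g : ι → ℕ → ℕ → ℝ)
    (n : ℕ) :
    (∑ c : Fin n → ι × Bool, ∏ i, g i (Finset.univ.filter fun a => c a = (i, false)).card
      (Finset.univ.filter fun a => c a = (i, true)).card) / (n ! : ℝ) =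
    PowerSeries.coeff n (∏ i, PowerSeries.mk fun N =>
      ∑ p ∈ Finset.HasAntidiagonal.antidiagonal N, g i p.1 p.2 / ((p.1)! * (p.2)! : ℝ)) := by
  rw [sum_fiber_card (fun s => ∏ i, g i (s (i, false)) (s (i, true))),
    ← sum_piAntidiag_eq_coeff_prod (fun i p => g i p.1 p.2 / ((p.1)! * (p.2)! : ℝ)),
    Finset.sum_div]
  refine Finset.sum_congr rfl fun s hs => ?_
  have h1 := Nat.multinomial_spec Finset.univ s
  rw [(Finset.mem_piAntidiag.1 hs).1] at h1
  rw [Finset.prod_div_distrib, ← h1]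
  have h2 : (∏ i, ((s (i, false))! * (s (i, true))! : ℝ)) = ((∏ k, (s k)! : ℕ) : ℝ) := by
    rw [Fintype.prod_prod_type]
    push_cast
    refine Finset.prod_congr rfl fun i _ => ?_
    rw [Fintype.prod_bool, mul_comm]
  rw [h2]
  have h3 : ((∏ k, (s k)! : ℕ) : ℝ) ≠ 0 :=
    Nat.cast_ne_zero.2 (Finset.prod_ne_zero_iff.2 fun k _ => Nat.factorial_ne_zero _)
  have h4 : (Nat.multinomial Finset.univ s : ℝ) ≠ 0 :=
    Nat.cast_ne_zero.2 (Nat.multinomial_pos _ _).ne'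
  rw [Nat.cast_mul]
  field_simp

end FiberCounting

/-! ### Counting configurations with given marks -/

section QuarkCounting

/-- The number of bipartite graphs with nonempty parts that are counted by `F`. -/
noncomputable def quarkNum (w : Mark × Mark) (p q : ℕ) : ℕ :=
  if 1 ≤ p ∧ 1 ≤ q then (middleQuarks w.1 w.2 p q).ncard else 0

theorem Mark.holds_congr {α β : Type*} (e : α ≃ β) {p : α → Prop} {q : β → Prop}
    (h : ∀ a, p a ↔ q (e a)) (m : Mark) : m.Holds p ↔ m.Holds q := by
  have : (∃ a, p a) ↔ ∃ b, q b := e.exists_congr h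
  cases m
  · exact this
  · exact not_congr this

theorem card_quarkSet {α β : Type*} [Fintype α] [Fintype β] (w : Mark × Mark) :
    Nat.card (quarkSet α β w) = quarkNum w (Fintype.card α) (Fintype.card β) := by
  unfold quarkNum
  split_ifs with h
  · rw [← Nat.card_coe_set_eq]
    have hα : Nonempty α := Fintype.card_pos_iff.1 h.1
    let e := Fintype.equivFin α
    let f := Fintype.equivFin β
    refine Nat.card_congr (Equiv.subtypeEquiv
      (Equiv.arrowCongr e (Equiv.arrowCongr f (Equiv.refl Prop))) fun G => ?_)
    have hG : ∀ a b, (Equiv.arrowCongr e (Equiv.arrowCongr f (Equiv.refl Prop))) G (e a) (f b) =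
        G a b := fun a b => by simp
    refine (and_iff_right hα).trans (and_congr (not_congr ?_) (and_congr (not_congr ?_)
      (and_congr ?_ ?_)))
    · exact e.exists_congr fun a => f.forall_congr fun {b} => by rw [hG]
    · exact f.exists_congr fun b => e.forall_congr fun {a} => by rw [hG]
    · exact Mark.holds_congr f (fun b => e.forall_congr fun {a} => by rw [hG]) _
    · exact Mark.holds_congr e (fun a => f.forall_congr fun {b} => by rw [hG]) _
  · rw [Nat.card_eq_zero]
    left
    refine ⟨fun ⟨G, ⟨a⟩, h1, _⟩ => h ⟨Fintype.card_pos_iff.2 ⟨a⟩, Fintype.card_pos_iff.2 ?_⟩⟩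
    -- Over an empty upper part, `a` would be vacuously adjacent to everything.
    by_contra hβ
    exact h1 ⟨a, fun b => absurd ⟨b⟩ hβ⟩

instance : DecidableEq Mark := fun a b => by
  cases a <;> cases b <;> first | exact isTrue rfl | exact isFalse (by simp)

instance : Fintype Mark := ⟨{.circ, .otimes}, fun m => by cases m <;> simp⟩

/-- The sets of `r` ranks that contain all ranks in which an all-seeing vertex is needed. -/
def Seers (r : ℕ) (w : Fin l → Mark × Mark) : Type :=
  {A : Finset (Fin (l + 1)) // (∀ j, Needed w j → j ∈ A) ∧ A.card = r}

instance (w : Fin l → Mark × Mark) : Finite (Seers r w) := Subtype.finite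

def configEquiv (l n r : ℕ) : Config l n r ≃ Σ w : Fin l → Mark × Mark, Seers r w ×
    Σ c : Fin n → Fin l × Bool, ∀ i, quarkSet {a // c a = (i, false)} {b // c b = (i, true)} (w i)
    where
  toFun C := ⟨C.mark, ⟨C.seers, C.mem_seers, C.card_seers⟩, C.side, fun i => ⟨C.adj i, C.adj_mem i⟩⟩
  invFun x := ⟨x.1, x.2.2.1, fun i => (x.2.2.2 i).1, x.2.1.1, fun i => (x.2.2.2 i).2, x.2.1.2.1,
    x.2.1.2.2⟩
  left_inv _ := rfl
  right_inv _ := rfl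

/-- Once the marks are fixed, the seers are chosen independently of the quarks, and the quarks
independently of each other given the sides. -/
theorem card_config (l n r : ℕ) : Nat.card (Config l n r) =
    ∑ w : Fin l → Mark × Mark, Nat.card (Seers r w) *
      ∑ c : Fin n → Fin l × Bool, ∏ i,
        quarkNum (w i) (Finset.univ.filter fun a => c a = (i, false)).card
          (Finset.univ.filter fun a => c a = (i, true)).card := by
  rw [Nat.card_congr (configEquiv l n r), Nat.card_sigma]
  refine Finset.sum_congr rfl fun w _ => ?_
  rw [Nat.card_prod, Nat.card_sigma]
  congr 1
  refine Finset.sum_congr rfl fun c _ => ?_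
  rw [Nat.card_pi]
  refine Finset.prod_congr rfl fun i _ => ?_
  rw [card_quarkSet, Fintype.card_subtype, Fintype.card_subtype]

theorem indecCount_eq (n r : ℕ) :
    indecCount n r = ∑ l ∈ Finset.range n, Nat.card (Config (l + 1) n r) := by
  have (l : ℕ) : Finite (Config l n r) := Finite.of_equiv _ (configEquiv l n r).symm
  rw [indecCount, ← Nat.card_eq_of_bijective _ (configClass_bijective n r), Nat.card_sigma,
    Finset.sum_range]

/-- The series `F`, as a power series in one variable. -/
noncomputable def quarkSeries (w : Mark × Mark) : PowerSeries ℝ :=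
  PowerSeries.mk (quarkCoeff w.1 w.2)

theorem quarkCoeff_eq (w : Mark × Mark) (N : ℕ) : quarkCoeff w.1 w.2 N =
    ∑ p ∈ Finset.HasAntidiagonal.antidiagonal N,
      (quarkNum w p.1 p.2 : ℝ) / ((p.1)! * (p.2)! : ℝ) := by
  rw [quarkCoeff, Finset.sum_filter]
  refine Finset.sum_congr rfl fun p _ => ?_
  unfold quarkNum
  split_ifs <;> simp

theorem card_config_div (l n r : ℕ) : (Nat.card (Config l n r) : ℝ) / (n ! : ℝ) =
    ∑ w : Fin l → Mark × Mark, (Nat.card (Seers r w) : ℝ) *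
      PowerSeries.coeff n (∏ i, quarkSeries (w i)) := by
  rw [card_config, Nat.cast_sum, Finset.sum_div]
  refine Finset.sum_congr rfl fun w _ => ?_
  have h := sum_prod_fiber_card (fun (i : Fin l) p q => (quarkNum (w i) p q : ℝ)) n
  simp only [← quarkCoeff_eq] at h
  unfold quarkSeries
  rw [← h]
  push_cast
  rw [mul_div_assoc]

end QuarkCounting

/-! ### The transfer matrix over `ℝ⟦x, z⟧` -/

/-- The variable `x` among the two variables `x` and `z`. -/
def varX : Unit ↪ Fin 2 := ⟨fun _ => 0, fun _ _ _ => rfl⟩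

/-- The inclusion of `ℝ⟦x⟧` into `ℝ⟦x, z⟧`. -/
noncomputable def inclX : PowerSeries ℝ →ₐ[ℝ] Series :=
  MvPowerSeries.rename varX

theorem coeff_inclX (p : PowerSeries ℝ) (d : Fin 2 →₀ ℕ) :
    MvPowerSeries.coeff d (inclX p) = if d 1 = 0 then PowerSeries.coeff (d 0) p else 0 := by
  split_ifs with h
  · have hd : d = Finsupp.embDomain varX
        (Finsupp.single () (d 0)) := by
      rw [Finsupp.embDomain_single, show varX () = 0 from rfl]
      ext i
      fin_cases i
      · simp
      · simpa using h
    conv_lhs => rw [hd]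
    exact MvPowerSeries.coeff_embDomain_rename _ _ _
  · refine MvPowerSeries.coeff_rename_eq_zero _ _ ?_
    rintro ⟨x, rfl⟩
    refine h (Finsupp.mapDomain_of_notMem_range _ _ ?_)
    rintro ⟨i, hi⟩
    exact absurd hi (show (0 : Fin 2) ≠ 1 by decide)

theorem coeff_inclX_mul_z_pow (p : PowerSeries ℝ) (k : ℕ) (d : Fin 2 →₀ ℕ) :
    MvPowerSeries.coeff d (inclX p * z ^ k) =
      if d 1 = k then PowerSeries.coeff (d 0) p else 0 := by
  rw [z, MvPowerSeries.X_pow_eq, MvPowerSeries.coeff_mul_monomial, coeff_inclX]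
  have h : Finsupp.single (1 : Fin 2) k ≤ d ↔ k ≤ d 1 := Finsupp.single_le_iff
  simp only [h, Finsupp.coe_tsub, Pi.sub_apply, Finsupp.single_eq_same, mul_one]
  rw [Finsupp.single_eq_of_ne (by decide), Nat.sub_zero]
  split_ifs <;> first | rfl | omega

theorem F_eq_inclX (w : Mark × Mark) : F w.1 w.2 = inclX (quarkSeries w) := by
  ext d
  rw [coeff_inclX, quarkSeries, PowerSeries.coeff_mk]
  rfl

/-- The marks of the rows and columns of the transfer matrix. -/
def markIndex : Fin 4 → Mark × Mark :=
  ![(.circ, .circ), (.circ, .otimes), (.otimes, .circ), (.otimes, .otimes)]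

theorem markIndex_bijective : Function.Bijective markIndex := by
  decide

/-- The generating function of the all-seeing vertices in a rank between quarks with the given
marks. -/
noncomputable def seerWeight (a b : Mark) : Series :=
  z + if a = .circ ∧ b = .circ then 0 else 1

theorem transferMatrix_apply (s t : Fin 4) : transferMatrix s t =
    seerWeight (markIndex s).2 (markIndex t).1 * F (markIndex t).1 (markIndex t).2 := by
  fin_cases s <;> fin_cases t <;> simp [transferMatrix, seerWeight, markIndex] <;> ring

theorem finalVector_apply (s : Fin 4) : finalVector s = seerWeight (markIndex s).2 .circ := by
  fin_cases s <;> simp [finalVector, seerWeight, markIndex, add_comm]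

/-- The absent quark below rank `0` acts like one with lower mark `circ`, which is the lower mark of
row `0`. -/
theorem initialVector_apply (t : Fin 4) : initialVector t = transferMatrix 0 t := by
  rw [transferMatrix_apply]
  fin_cases t <;> simp [initialVector, seerWeight, markIndex, add_comm]

/-- Path expansion: rank `j` is weighted by the lower mark of the quark below it and the upper mark
of the quark above it. `Fin.cons` supplies the former at the bottom, from the row `s`, and
`Fin.snoc` the latter at the top, as `circ`. -/
theorem transferMatrix_pow_mulVec (l : ℕ) (s : Fin 4) :
    (transferMatrix ^ l *ᵥ finalVector) s = ∑ w : Fin l → Mark × Mark,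
      (∏ i, F (w i).1 (w i).2) * ∏ j : Fin (l + 1),
        seerWeight (Fin.cons (α := fun _ => Mark) (markIndex s).2 (fun i => (w i).2) j)
          (Fin.snoc (α := fun _ => Mark) (fun i => (w i).1) .circ j) := by
  induction l generalizing s with
  | zero =>
    simp [finalVector_apply, Fin.snoc]
  | succ l ih =>
    rw [pow_succ', ← Matrix.mulVec_mulVec, Matrix.mulVec, dotProduct,
      ← (Fin.consEquiv fun _ => Mark × Mark).sum_comp, Fintype.sum_prod_type,
      ← (Equiv.ofBijective _ markIndex_bijective).sum_comp]
    refine Finset.sum_congr rfl fun t _ => ?_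
    rw [ih, Finset.mul_sum]
    refine Finset.sum_congr rfl fun w _ => ?_
    rw [transferMatrix_apply]
    conv_rhs => rw [Fin.prod_univ_succ, Fin.prod_univ_succ (n := l + 1)]
    have h1 : ∀ j : Fin (l + 1), Fin.cons (α := fun _ => Mark) (markIndex t).2
        (fun i => (w i).2) j = ((Fin.cons (α := fun _ => Mark × Mark) (markIndex t) w) j).2 := by
      intro j
      cases j using Fin.cases <;> rfl
    have h2 : (fun i => ((Fin.cons (α := fun _ => Mark × Mark) (markIndex t) w) i).1) =
        Fin.cons (α := fun _ => Mark) (markIndex t).1 (fun i => (w i).1) := by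
      funext j
      cases j using Fin.cases <;> rfl
    simp only [Fin.consEquiv_apply, Equiv.ofBijective_apply, h1, h2, Fin.cons_zero, Fin.cons_succ,
      ← Fin.cons_snoc_eq_snoc_cons]
    ring

theorem needed_iff {l : ℕ} (w : Fin l → Mark × Mark) (j : Fin (l + 1)) :
    Needed w j ↔ Fin.cons (α := fun _ => Mark) .circ (fun i => (w i).2) j = Mark.circ ∧
      Fin.snoc (α := fun _ => Mark) (fun i => (w i).1) .circ j = Mark.circ := by
  refine and_congr ?_ ?_
  · cases j using Fin.cases with
    | zero => simp
    | succ i => simp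
  · cases j using Fin.lastCases with
    | last => simp [Fin.castSucc_ne_last]
    | cast i => simp

/-- In the expanded product, `A` collects the ranks from which `z` is taken. The other factors are
`1`, except that a needed rank outside `A` contributes `0`. -/
theorem prod_seerWeight {l : ℕ} (w : Fin l → Mark × Mark) :
    ∏ j : Fin (l + 1), seerWeight (Fin.cons (α := fun _ => Mark) .circ (fun i => (w i).2) j)
      (Fin.snoc (α := fun _ => Mark) (fun i => (w i).1) .circ j) =
    ∑ A : Finset (Fin (l + 1)), open Classical in
      if ∀ j, Needed w j → j ∈ A then z ^ A.card else 0 := by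
  classical
  simp only [seerWeight]
  rw [Fintype.prod_add]
  refine Finset.sum_congr rfl fun A _ => ?_
  rw [Finset.prod_const]
  simp only [← needed_iff]
  split_ifs with h
  · rw [Finset.prod_eq_one, mul_one]
    intro j hj
    exact if_neg fun hn => Finset.mem_compl.1 hj (h j hn)
  · push Not at h
    obtain ⟨j, hn, hj⟩ := h
    refine mul_eq_zero_of_right _ (Finset.prod_eq_zero (Finset.mem_compl.2 hj) ?_)
    exact if_pos hn

theorem coeff_transferMatrix_pow_mulVec (l : ℕ) (d : Fin 2 →₀ ℕ) :
    MvPowerSeries.coeff d ((transferMatrix ^ l *ᵥ finalVector) 0) =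
      (Nat.card (Config l (d 0) (d 1)) : ℝ) / ((d 0)! : ℝ) := by
  classical
  rw [card_config_div, transferMatrix_pow_mulVec, map_sum]
  refine Finset.sum_congr rfl fun w _ => ?_
  rw [show (markIndex 0).2 = .circ from rfl, prod_seerWeight, Finset.mul_sum, map_sum]
  simp only [F_eq_inclX, ← map_prod, mul_ite, mul_zero, apply_ite (MvPowerSeries.coeff d),
    coeff_inclX_mul_z_pow, map_zero, ← ite_and]
  have h : Nat.card (Seers (d 1) w) = (Finset.univ.filter fun A : Finset (Fin (l + 1)) =>
      (∀ j, Needed w j → j ∈ A) ∧ d 1 = A.card).card := by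
    rw [Seers, Nat.card_eq_fintype_card, Fintype.card_subtype]
    simp only [eq_comm]
  rw [h, ← Finset.sum_filter, Finset.sum_const, nsmul_eq_mul]

/-- Quarks have vertices. This makes `1 - transferMatrix` invertible and lets the geometric series
be truncated. -/
theorem X_dvd_F (ν μ : Mark) : (MvPowerSeries.X 0 : Series) ∣ F ν μ := by
  rw [MvPowerSeries.X_dvd_iff]
  intro d hd
  rw [F_eq_inclX (ν, μ), coeff_inclX, hd, quarkSeries, PowerSeries.coeff_mk]
  simp [quarkCoeff, Finset.sum_filter]

theorem X_dvd_transferMatrix :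
    ∃ N : Matrix (Fin 4) (Fin 4) Series, transferMatrix = (MvPowerSeries.X 0 : Series) • N := by
  have h : ∀ s t, ∃ y, transferMatrix s t = (MvPowerSeries.X 0 : Series) * y := fun s t => by
    rw [transferMatrix_apply]
    exact (X_dvd_F _ _).mul_left _
  choose N hN using h
  exact ⟨Matrix.of N, Matrix.ext fun s t => hN s t⟩

theorem isUnit_one_sub_transferMatrix : IsUnit (1 - transferMatrix) := by
  rw [Matrix.isUnit_iff_isUnit_det, MvPowerSeries.isUnit_iff_constantCoeff, RingHom.map_det]
  obtain ⟨N, hN⟩ := X_dvd_transferMatrix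
  have h : (MvPowerSeries.constantCoeff (σ := Fin 2) (R := ℝ)).mapMatrix (1 - transferMatrix) =
      1 := by
    rw [map_sub, map_one, hN, sub_eq_self]
    ext s t
    simp
  rw [h, Matrix.det_one]
  exact isUnit_one

theorem indecSeries_eq : indecSeries =
    initialVector ⬝ᵥ ((1 - transferMatrix)⁻¹ *ᵥ finalVector) := by
  have hM := isUnit_one_sub_transferMatrix
  rw [Matrix.isUnit_iff_isUnit_det] at hM
  obtain ⟨N, hN⟩ := X_dvd_transferMatrix
  ext d
  -- The initial vector supplies one more factor of the matrix, so the remainder is divisible by the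
  -- power `d 0 + 1` of `x` and does not reach the coefficient at `d`. The terms kept correspond to
  -- `l + 1 ≤ d 0` quarks, the range allowed by `Config.lt_card`.
  have hinv : (1 - transferMatrix)⁻¹ = ∑ i ∈ Finset.range (d 0), transferMatrix ^ i +
      transferMatrix ^ d 0 * (1 - transferMatrix)⁻¹ := by
    have h := geom_sum_mul_neg transferMatrix (d 0)
    have h2 := congrArg (· * (1 - transferMatrix)⁻¹) h
    simp only [Matrix.mul_assoc, Matrix.mul_nonsing_inv _ hM, Matrix.mul_one, sub_mul,
      one_mul] at h2
    rw [h2, sub_add_cancel]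
  have hinit : initialVector = fun t => transferMatrix 0 t := funext initialVector_apply
  have hdot : ∀ v, initialVector ⬝ᵥ v = (transferMatrix *ᵥ v) 0 := fun v => by
    rw [hinit]
    rfl
  rw [hdot, hinv, Matrix.add_mulVec, Matrix.mulVec_add, Pi.add_apply, map_add]
  have hzero : MvPowerSeries.coeff d
      ((transferMatrix *ᵥ (transferMatrix ^ d 0 * (1 - transferMatrix)⁻¹) *ᵥ finalVector) 0) =
      0 := by
    rw [Matrix.mulVec_mulVec, ← Matrix.mul_assoc, ← pow_succ']
    refine MvPowerSeries.X_pow_dvd_iff.1 ?_ d (Nat.lt_succ_self (d 0))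
    conv_rhs => rw [hN]
    rw [smul_pow, Matrix.smul_mul, Matrix.smul_mulVec]
    exact dvd_mul_right _ _
  rw [hzero, add_zero, Matrix.sum_mulVec, Matrix.mulVec_sum, Finset.sum_apply, map_sum]
  simp only [Matrix.mulVec_mulVec, ← pow_succ', coeff_transferMatrix_pow_mulVec]
  rw [← Finset.sum_div, ← Nat.cast_sum, ← indecCount_eq]
  rfl

end TrimmedPosets

theorem mainTheorem9 :
    IsUnit (1 - TrimmedPosets.transferMatrix) ∧
    TrimmedPosets.indecSeries =
      TrimmedPosets.initialVector ⬝ᵥ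
        ((1 - TrimmedPosets.transferMatrix)⁻¹ *ᵥ TrimmedPosets.finalVector) :=
  ⟨TrimmedPosets.isUnit_one_sub_transferMatrix, TrimmedPosets.indecSeries_eq⟩
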